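/- Let $G=(V,E)$ be a finite connected undirected graph (without loops) with symmetric positive real edge weights $\omega(i,j)$ (all equal to $1$ in the unweighted case; put $\omega(i,j)=0$ if $\{i,j\}\notin E$). Consider the random walk on $G$ which moves from $i$ to $j$ with probability $p_{ij}=\omega(i,j)/\sum_l\omega(i,l)$ (if $|V|=1$ the walk stays where it is). The hitting time $h_{x,A}$ is the expected number of steps until the first visit to $A$ of the walk started at $x$, and the cover time $C_i(G)$ is the expected number of steps until the walk started at $i$ has visited all vertices. Let $\mathcal G$ be the directed graph on the pairs $(P,i)$, $P\subseteq V$, $i\in V$, with the walk that moves from $(P,i)$ to $(P\cup\{j\},j)$ with probability $p_{ij}$, and let all states $(V,k)$ be identified to one state $f$. Write $h_{(P,i),f}$ for the hitting time of $f$ in $\mathcal G$. For $P\subsetneq V$ let $p(P,i,j)$ be the probability that $j$ is the first vertex outside $P$ hit by the walk on $G$ started at $i$, and, for $i \in P$, let $s(P,i)$ be the expected time the walk started at $i$ stays in $P$, i.e. the expected number of steps from a vertex of $P$ to a vertex of $P$ made before the walk leaves $P$ for the first time. Then: 1. $C_i(G)=h_{(\{i\},i),f}$ for every $i\in V$, and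 $h_{(V,i),f}=0$. 2. For all $i\in P\subsetneq V$, $h_{(P,i),f}$ is finite and $$h_{(P,i),f}=1+s(P,i)+\sum_{j\in V\setminus P}p(P,i,j)\,h_{(P\cup\{j\},j),f}.$$ 3. For all $i\in P\subsetneq V$, $1+s(P,i)=h_{i,V\setminus P}$ is the hitting time of $V\setminus P$ from $i$ in $G$. 4. For all $P\subsetneq V$ and $j\in V\setminus P$, the function $i\mapsto p(P,i,j)$ is the potential for the conductances $\omega$ when $j$ has potential $1$ and all other vertices of $V\setminus P$ have potential $0$: it is the unique $\varphi:V\to\mathbb R$ with $\varphi(j)=1$, $\varphi(k)=0$ for $k\in V\setminus(P\cup\{j\})$, and $\sum_l\omega(k,l)(\varphi(k)-\varphi(l))=0$ for all $k\in P$. 5. There is an algorithm which, given $n$, a connected weighted graph $G$ on $\{0,\dots,n-1\}$ by its matrix of weights, and a starting vertex $i$, computes $C_i(G)$ in time $O(n^32^n)$. Precisely: there are one fixed program for a real random-access machine (unit cost for $+,-,\times,/$ and comparison of real numbers, for $+,-$ and comparison of natural numbers, and for array access) and one constant $C$ such that, for every $n$ and every such input, the program halts with output $C_i(G)$ after at most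 $C\,n^3 2^n$ steps. -/

import Mathlib

open MeasureTheory ProbabilityTheory
open scoped ENNReal

noncomputable section

/-! ### Markov chains with countable state space -/

section MarkovChain

variable {S : Type*} [Countable S] [MeasurableSpace S] [MeasurableSingletonClass S]

/-- The transition kernel, from trajectories up to time `n` to states at time `n + 1`, of the Markov
chain whose transition probabilities out of a state `b` are given by `step b`. -/
def chainKernel (step : S → PMF S) (n : ℕ) : Kernel (Finset.Iic n → S) S :=
  (Kernel.ofFunOfCountable fun b => (step b).toMeasure).comap
    (fun h : (Finset.Iic n → S) => h ⟨n, Finset.mem_Iic.2 le_rfl⟩) (measurable_pi_apply _)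

instance (step : S → PMF S) (n : ℕ) : IsMarkovKernel (chainKernel step n) :=
  ⟨fun h => inferInstanceAs
    (IsProbabilityMeasure (step (h ⟨n, Finset.mem_Iic.2 le_rfl⟩)).toMeasure)⟩

/-- The law on the space of trajectories `ℕ → S` of the time-homogeneous Markov chain which is at
`a` at time `0` and whose transition probabilities out of a state `b` are given by `step b`. -/
def chainLaw (step : S → PMF S) (a : S) : Measure (ℕ → S) :=
  Kernel.traj (X := fun _ => S) (chainKernel step) 0 (fun _ => a)

end MarkovChain

/-- The first time at which `E` holds, and `∞` if `E` never holds. -/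
def firstTime (E : ℕ → Prop) : ℝ≥0∞ := ⨅ (t : ℕ) (_ : E t), (t : ℝ≥0∞)

/-- The hitting time `h_{a,A}` of the set `A` from `a`: the expected number of steps which the
Markov chain makes until its first visit to `A`. -/
def hittingTime {S : Type*} [Countable S] [MeasurableSpace S] [MeasurableSingletonClass S]
    (step : S → PMF S) (a : S) (A : Set S) : ℝ≥0∞ :=
  ∫⁻ x, firstTime (fun t => x t ∈ A) ∂(chainLaw step a)

/-! ### Weighted graphs and their random walks -/

/-- A simple undirected graph whose edges carry positive real weights. -/
structure WeightedGraph (V : Type*) where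
  graph : SimpleGraph V
  weight : V → V → ℝ
  weight_symm : ∀ i j, weight i j = weight j i
  weight_pos : ∀ i j, graph.Adj i j → 0 < weight i j
  weight_eq_zero : ∀ i j, ¬ graph.Adj i j → weight i j = 0

namespace WeightedGraph

variable {V : Type*} [Fintype V]

open Classical in
/-- One step of the random walk: from `i` the token moves to `j` with probability
`ω(i,j) / ω(i)`, where `ω(i) = ∑ j, ω(i,j)`. (An isolated vertex, which in a connected graph can
only be the single vertex of a one-vertex graph, keeps the token.) -/
def step (G : WeightedGraph V) (i : V) : PMF V :=
  if h : (∑' j, ENNReal.ofReal (G.weight i j)) = 0 then PMF.pure i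
  else PMF.normalize (fun j => ENNReal.ofReal (G.weight i j)) h
    (by rw [tsum_fintype]; exact ENNReal.sum_ne_top.2 fun _ _ => ENNReal.ofReal_ne_top)

variable [MeasurableSpace V] [MeasurableSingletonClass V]

/-- The cover time `C_i(G)`: the expected number of steps which the random walk started at `i`
makes until it has visited every vertex. -/
def coverTime (G : WeightedGraph V) (i : V) : ℝ≥0∞ :=
  ∫⁻ x, firstTime (fun t => ∀ v, ∃ u ≤ t, x u = v) ∂(chainLaw G.step i)

/-- `p(P,i,j)`: the probability that the first vertex outside `P` which is hit by the random walk
started at `i` is `j`. -/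
def exitProb (G : WeightedGraph V) (P : Finset V) (i j : V) : ℝ≥0∞ :=
  chainLaw G.step i {x | ∃ t, (∀ u < t, x u ∈ P) ∧ x t ∉ P ∧ x t = j}

/-- `s(P,i)`: the expected time the random walk started at `i` stays in `P`, that is, the expected
number of steps inside `P` (from a vertex of `P` to a vertex of `P`) which it makes before it
leaves `P` for the first time. -/
def stayTime (G : WeightedGraph V) (P : Finset V) (i : V) : ℝ≥0∞ :=
  ∫⁻ x, (({t : ℕ | ∀ u ≤ t + 1, x u ∈ P}.encard : ℕ∞) : ℝ≥0∞) ∂(chainLaw G.step i)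

/-- `φ` is the electrical potential, for the conductances `ω`, when `j` is held at potential `1`
and all other vertices outside `P` are held at potential `0`: at every vertex `k` of `P`
Kirchhoff's current law holds, so that `φ` is harmonic there. -/
def IsPotential (G : WeightedGraph V) (P : Finset V) (j : V) (φ : V → ℝ) : Prop :=
  φ j = 1 ∧ (∀ k, k ∉ P → k ≠ j → φ k = 0) ∧
    ∀ k ∈ P, ∑ l, G.weight k l * (φ k - φ l) = 0

variable [DecidableEq V]

/-- One step of the walk on the associated directed graph `𝒢`, whose vertices are the pairs
`(P, i)` of a set `P` of already visited vertices and the current location `i` of the token.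
The token moves from `(P, i)` to `(P ∪ {j}, j)` (which is `(P, j)` if `j ∈ P`) with the probability
with which the random walk on `G` moves from `i` to `j`. -/
def assocStep (G : WeightedGraph V) (y : Finset V × V) : PMF (Finset V × V) :=
  (G.step y.2).map fun j => (insert j y.1, j)

/-- The set of the states `(V, k)` in which all vertices have been visited, which are identified
to the single absorbing state `f`. -/
def covered (V : Type*) [Fintype V] : Set (Finset V × V) := {y | y.1 = Finset.univ}

/-- `h_{(P,i),f}`: the hitting time to `f` from `(P, i)` in the associated graph `𝒢`. -/
def hitCovered (G : WeightedGraph V) (P : Finset V) (i : V) : ℝ≥0∞ :=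
  hittingTime G.assocStep (P, i) (covered V)

end WeightedGraph

/-! ### Programs on a real random-access machine

The machine has registers and arrays for natural numbers and for real numbers. Natural numbers
serve as counters and addresses and can only be added, subtracted (to `0` if the result would be
negative) and compared; real numbers can be added, subtracted, multiplied, divided and compared.
Each such operation, each access to an array and each evaluation of a test costs one unit of time.
A program refers to finitely many registers and arrays, fixed in advance. -/

/-- A configuration of the memory: registers, and arrays (indexed by the number of the array and
the position in it). -/
structure RAMState where
  natReg : ℕ → ℕ
  realReg : ℕ → ℝ
  natArr : ℕ → ℕ → ℕ
  realArr : ℕ → ℕ → ℝ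

/-- Tests compare the contents of two registers. -/
inductive RAMTest
  | natLt (a b : ℕ)
  | realLt (a b : ℕ)

/-- Programs. Except for the constants `c`, arguments are numbers of registers (`d`, `a`, `b`) or
of arrays (`m`). -/
inductive RAMProg
  | skip
  | natConst (d c : ℕ)
  | natAdd (d a b : ℕ)
  | natSub (d a b : ℕ)
  | natLoad (d m a : ℕ)
  | natStore (m a b : ℕ)
  | realConst (d : ℕ) (c : ℤ)
  | realAdd (d a b : ℕ)
  | realSub (d a b : ℕ)
  | realMul (d a b : ℕ)
  | realDiv (d a b : ℕ)
  | realLoad (d m a : ℕ)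
  | realStore (m a b : ℕ)
  | seq (p q : RAMProg)
  | ite (c : RAMTest) (p q : RAMProg)
  | while (c : RAMTest) (p : RAMProg)

namespace RAMState

def setNat (σ : RAMState) (d v : ℕ) : RAMState :=
  { σ with natReg := Function.update σ.natReg d v }

def setReal (σ : RAMState) (d : ℕ) (v : ℝ) : RAMState :=
  { σ with realReg := Function.update σ.realReg d v }

def setNatArr (σ : RAMState) (m k v : ℕ) : RAMState :=
  { σ with natArr := Function.update σ.natArr m (Function.update (σ.natArr m) k v) }

def setRealArr (σ : RAMState) (m k : ℕ) (v : ℝ) : RAMState :=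
  { σ with realArr := Function.update σ.realArr m (Function.update (σ.realArr m) k v) }

end RAMState

/-- The test succeeds. -/
def RAMTest.Holds : RAMTest → RAMState → Prop
  | natLt a b, σ => σ.natReg a < σ.natReg b
  | realLt a b, σ => σ.realReg a < σ.realReg b

/-- `RAMProg.Exec p σ t τ`: the program `p`, started in the configuration `σ`, halts after exactly
`t` units of time in the configuration `τ`. A division by zero never completes. -/
inductive RAMProg.Exec : RAMProg → RAMState → ℕ → RAMState → Prop
  | skip (σ) : Exec .skip σ 1 σ
  | natConst (σ d c) : Exec (.natConst d c) σ 1 (σ.setNat d c)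
  | natAdd (σ d a b) : Exec (.natAdd d a b) σ 1 (σ.setNat d (σ.natReg a + σ.natReg b))
  | natSub (σ d a b) : Exec (.natSub d a b) σ 1 (σ.setNat d (σ.natReg a - σ.natReg b))
  | natLoad (σ d m a) : Exec (.natLoad d m a) σ 1 (σ.setNat d (σ.natArr m (σ.natReg a)))
  | natStore (σ m a b) :
      Exec (.natStore m a b) σ 1 (σ.setNatArr m (σ.natReg a) (σ.natReg b))
  | realConst (σ d c) : Exec (.realConst d c) σ 1 (σ.setReal d (c : ℝ))
  | realAdd (σ d a b) : Exec (.realAdd d a b) σ 1 (σ.setReal d (σ.realReg a + σ.realReg b))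
  | realSub (σ d a b) : Exec (.realSub d a b) σ 1 (σ.setReal d (σ.realReg a - σ.realReg b))
  | realMul (σ d a b) : Exec (.realMul d a b) σ 1 (σ.setReal d (σ.realReg a * σ.realReg b))
  | realDiv (σ d a b) (h : σ.realReg b ≠ 0) :
      Exec (.realDiv d a b) σ 1 (σ.setReal d (σ.realReg a / σ.realReg b))
  | realLoad (σ d m a) : Exec (.realLoad d m a) σ 1 (σ.setReal d (σ.realArr m (σ.natReg a)))
  | realStore (σ m a b) :
      Exec (.realStore m a b) σ 1 (σ.setRealArr m (σ.natReg a) (σ.realReg b))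
  | seq {p q σ τ ρ s t} (hp : Exec p σ s τ) (hq : Exec q τ t ρ) :
      Exec (.seq p q) σ (s + t) ρ
  | ite_true {c p q σ τ t} (hc : c.Holds σ) (hp : Exec p σ t τ) :
      Exec (.ite c p q) σ (t + 1) τ
  | ite_false {c p q σ τ t} (hc : ¬ c.Holds σ) (hq : Exec q σ t τ) :
      Exec (.ite c p q) σ (t + 1) τ
  | while_true {c p σ τ ρ s t} (hc : c.Holds σ) (hp : Exec p σ s τ)
      (hw : Exec (.while c p) τ t ρ) : Exec (.while c p) σ (s + t + 1) ρ
  | while_false {c p σ} (hc : ¬ c.Holds σ) : Exec (.while c p) σ 1 σ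

/-- The initial configuration for a weighted graph on the vertices `0, …, n - 1` and a starting
vertex `i`: register `0` holds `n`, register `1` holds `i`, array `0` holds the weight `ω(k,l)` at
position `k * n + l`, and everything else is `0`. -/
def coverInput {n : ℕ} (G : WeightedGraph (Fin n)) (i : Fin n) : RAMState where
  natReg := fun r => if r = 0 then n else if r = 1 then (i : ℕ) else 0
  realReg := fun _ => 0
  natArr := fun _ _ => 0
  realArr := fun m a =>
    if m = 0 then ∑ k : Fin n, ∑ l : Fin n, if a = (k : ℕ) * n + l then G.weight k l else 0
    else 0

end

/-! The walk on `𝒢` is the walk on `G` together with a record of the visited vertices, so it reaches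
`f` exactly when the walk on `G` has covered `V`. No coupling of the two trajectory spaces is built:
both expectations, truncated at time `n`, satisfy the same one-step recurrence, and induction on `n`
followed by monotone convergence identifies them (`lintegral_min_firstTime_coveredBy`).

The remaining claims concern one boundary value problem: prescribe `Δφ(k) = ∑ ω(k,l)(φ(k) - φ(l))`
on `P` and `φ` outside `P`. On a connected graph the minimum principle
(`nonneg_of_laplacian_nonneg`) gives uniqueness, and linear algebra turns uniqueness into existence.
First step analysis, an equation `u(k) = c + ∑ p_{kl} u(l)`, becomes `Δu(k) = c·ω(k)` after
multiplication by the degree `ω(k)`, provided that `u` is finite (`laplacian_toReal`). Exit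
probabilities are the case `c = 0`. Exit times are finite because a hitting time is the least
supersolution of its first step equations and the boundary value problem supplies a finite one.

For the recursion, fix `P` and compare `k ↦ h_{(P ∪ {k}, k), f}` with `k ↦ h_{k, V∖P} + ∑ p(P,k,j)
h_{(P ∪ {j}, j), f}`. Both have `Δ = ω(k)` on `P` and the same values outside `P`, hence they
coincide. The finiteness needed here comes from an inequality proved by truncation and from
induction on the number of unvisited vertices.

The algorithm solves this boundary value problem once for each proper subset `P`. The boundary
values belong to the larger sets `P ∪ {k}`, so descending binary order makes them available, and `P
= ∅` yields the cover times. Every leading block of the matrix is nonsingular, by uniqueness for a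
subset of `P` (`leadingRegular_systemMatrix`); hence Gauss–Jordan elimination never meets a zero
pivot and takes `O(n^3)` steps for each of the `2^n - 1` sets. -/

noncomputable section

/-! ### Path probabilities and the Markov property -/

section MarkovChain

variable {S : Type*} [Countable S] [MeasurableSpace S] [MeasurableSingletonClass S]

instance (step : S → PMF S) (a : S) : IsProbabilityMeasure (chainLaw step a) :=
  inferInstanceAs (IsProbabilityMeasure (Kernel.traj (X := fun _ => S) (chainKernel step) 0 _))

omit [Countable S] in
theorem measurableSet_cylinder_prefix (n : ℕ) (s : ℕ → S) :
    MeasurableSet {x : ℕ → S | ∀ u ≤ n, x u = s u} := by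
  have : {x : ℕ → S | ∀ u ≤ n, x u = s u} =
      ⋂ u, ⋂ (_ : u ≤ n), (fun x : ℕ → S => x u) ⁻¹' {s u} := by
    ext x; simp
  rw [this]
  exact MeasurableSet.iInter fun u => MeasurableSet.iInter fun _ =>
    measurable_pi_apply u (measurableSet_singleton _)

open Classical in
/-- The probability that the chain follows the path `s` up to time `n`. -/
theorem chainLaw_cylinder (step : S → PMF S) (a : S) (n : ℕ) (s : ℕ → S) :
    chainLaw step a {x | ∀ u ≤ n, x u = s u} =
      (if a = s 0 then 1 else 0) * ∏ u ∈ Finset.range n, step (s u) (s (u + 1)) := by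
  have hF : ∀ n, Measurable fun z : Finset.Iic n → S =>
      Set.indicator {x : ℕ → S | ∀ u ≤ n, x u = s u} (1 : (ℕ → S) → ℝ≥0∞)
        (Function.updateFinset (fun _ => a) (Finset.Iic n) z) := fun n =>
    (measurable_one.indicator (measurableSet_cylinder_prefix n s)).comp measurable_updateFinset
  have key : ∀ n : ℕ, Kernel.lmarginalPartialTraj (X := fun _ => S) (chainKernel step) 0 n
      (Set.indicator {x | ∀ u ≤ n, x u = s u} 1) (fun _ => a) =
      (if a = s 0 then 1 else 0) * ∏ u ∈ Finset.range n, step (s u) (s (u + 1)) := by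
    intro n
    induction n with
    | zero =>
      rw [Kernel.lmarginalPartialTraj_le _ le_rfl
        (measurable_one.indicator (measurableSet_cylinder_prefix 0 s))]
      simp [Set.indicator_apply]
    | succ n ih =>
      have hm := measurable_one (α := ℝ≥0∞).indicator (measurableSet_cylinder_prefix (n + 1) s)
      rw [← Kernel.lmarginalPartialTraj_self (Nat.zero_le n) n.le_succ hm]
      -- Integrating out the last coordinate splits off the last transition probability: on the
      -- shorter cylinder the integrand is the indicator of the point `s (n + 1)`, off it the
      -- integrand vanishes.
      have h1 : Kernel.lmarginalPartialTraj (X := fun _ => S) (chainKernel step) n (n + 1)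
          (Set.indicator {x | ∀ u ≤ n + 1, x u = s u} 1) =
          fun x => step (s n) (s (n + 1)) * Set.indicator {x | ∀ u ≤ n, x u = s u} 1 x := by
        funext x
        rw [Kernel.lmarginalPartialTraj_succ _ hm]
        change ∫⁻ y : S, _ ∂(step (x n)).toMeasure = _
        by_cases hx : ∀ u ≤ n, x u = s u
        · have h2 : (fun y : S => Set.indicator {x : ℕ → S | ∀ u ≤ n + 1, x u = s u}
              (1 : (ℕ → S) → ℝ≥0∞) (Function.update x (n + 1) y)) =
              Set.indicator {s (n + 1)} 1 := by
            funext y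
            have : (∀ u ≤ n + 1, Function.update x (n + 1) y u = s u) ↔ y = s (n + 1) := by
              constructor
              · intro h; simpa using h (n + 1) le_rfl
              · intro h u hu
                rcases Nat.lt_or_eq_of_le hu with hu | rfl
                · rw [Function.update_of_ne hu.ne]; exact hx u (by omega)
                · simpa using h
            simp [Set.indicator_apply, this]
          rw [h2, lintegral_indicator_one (measurableSet_singleton _),
            PMF.toMeasure_apply_singleton _ _ (measurableSet_singleton _), hx n le_rfl]
          rw [Set.indicator_of_mem (by exact hx)]
          simp
        · have h2 : (fun y : S => Set.indicator {x : ℕ → S | ∀ u ≤ n + 1, x u = s u}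
              (1 : (ℕ → S) → ℝ≥0∞) (Function.update x (n + 1) y)) = fun _ => 0 := by
            funext y
            have : ¬ (∀ u ≤ n + 1, Function.update x (n + 1) y u = s u) := by
              intro h; apply hx; intro u hu
              have := h u (by omega)
              rwa [Function.update_of_ne (by omega)] at this
            simp [this]
          rw [h2]
          simp [hx]
      rw [h1, Kernel.lmarginalPartialTraj, lintegral_const_mul _ (hF n)]
      rw [Kernel.lmarginalPartialTraj] at ih
      rw [ih, Finset.prod_range_succ]
      ring
  rw [← key n, Kernel.lmarginalPartialTraj, chainLaw]
  have hr : (Preorder.frestrictLe (π := fun _ : ℕ => S) 0) (fun _ => a) = fun _ => a := rfl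
  rw [hr, ← Kernel.traj_map_frestrictLe_apply,
    lintegral_map (hF n) (by fun_prop),
    ← lintegral_indicator_one (measurableSet_cylinder_prefix n s)]
  refine lintegral_congr fun x => ?_
  have : (∀ u ≤ n, Function.updateFinset (fun _ => a) (Finset.Iic n)
      (Preorder.frestrictLe (π := fun _ : ℕ => S) n x) u = s u) ↔ ∀ u ≤ n, x u = s u := by
    refine forall_congr' fun u => forall_congr' fun hu => ?_
    simp [Function.updateFinset, hu]
  simp only [Set.indicator_apply, Set.mem_ofPred_eq, this, Pi.one_apply]

/-- The trajectory which starts at `a` and goes on as `y`. -/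
def consTraj (a : S) (y : ℕ → S) : ℕ → S := fun t => Nat.casesOn t a y

omit [Countable S] [MeasurableSingletonClass S] in
theorem measurable_consTraj (a : S) : Measurable (consTraj a) := by
  refine measurable_pi_iff.2 fun t => ?_
  cases t with
  | zero => exact measurable_const
  | succ t => exact measurable_pi_apply t

/-- The Markov property at time `1`. -/
theorem chainLaw_eq_sum (step : S → PMF S) (a : S) :
    chainLaw step a =
      Measure.sum fun b => step a b • (chainLaw step b).map (consTraj a) := by
  classical
  refine IsProjectiveLimit.unique (P := fun I => (chainLaw step a).map I.restrict)
    (fun I => rfl) (fun I => ?_)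
  -- The sets `Iic n` are cofinal among the finite sets of times. The marginals on them live on
  -- countable spaces, so they only have to agree on singletons, that is, on cylinders.
  have hn : ∀ n : ℕ, (Measure.sum fun b => step a b • (chainLaw step b).map (consTraj a)).map
      (Finset.Iic n).restrict = (chainLaw step a).map (Finset.Iic n).restrict := by
    intro n
    refine Measure.ext_of_singleton fun s => ?_
    obtain ⟨s', hs'⟩ : ∃ s' : ℕ → S, ∀ u (hu : u ∈ Finset.Iic n), s' u = s ⟨u, hu⟩ :=
      ⟨fun u => if hu : u ∈ Finset.Iic n then s ⟨u, hu⟩ else a, fun u hu => by simp only [hu, dif_pos]⟩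
    have hpre : (Finset.Iic n).restrict ⁻¹' ({s} : Set (Finset.Iic n → S)) = {x : ℕ → S | ∀ u ≤ n, x u = s' u} := by
      ext x
      simp only [Set.mem_preimage, Set.mem_singleton_iff, funext_iff, Set.mem_ofPred_eq,
        Finset.restrict]
      constructor
      · intro h u hu; rw [h ⟨u, Finset.mem_Iic.2 hu⟩, hs']
      · rintro h ⟨u, hu⟩; rw [← hs' u hu]; exact h u (Finset.mem_Iic.1 hu)
    have hm := measurableSet_cylinder_prefix n s'
    rw [Measure.map_apply (by fun_prop) (measurableSet_singleton _),
      Measure.map_apply (by fun_prop) (measurableSet_singleton _), hpre, Measure.sum_apply _ hm]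
    simp only [Measure.smul_apply, smul_eq_mul, Measure.map_apply (measurable_consTraj a) hm]
    rw [chainLaw_cylinder]
    cases n with
    | zero =>
      have : ∀ b, chainLaw step b (consTraj a ⁻¹' {x | ∀ u ≤ 0, x u = s' u}) =
          if a = s' 0 then 1 else 0 := by
        intro b
        by_cases h : a = s' 0
        · have : consTraj a ⁻¹' {x | ∀ u ≤ 0, x u = s' u} = Set.univ := by
            ext; simp [consTraj, h]
          rw [this, if_pos h, measure_univ]
        · have : consTraj a ⁻¹' {x | ∀ u ≤ 0, x u = s' u} = ∅ := by
            ext; simp [consTraj, h]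
          rw [this, if_neg h, measure_empty]
      simp only [this, ENNReal.tsum_mul_right, PMF.tsum_coe]
      simp
    | succ n =>
      have : ∀ b, chainLaw step b (consTraj a ⁻¹' {x | ∀ u ≤ n + 1, x u = s' u}) =
          (if a = s' 0 then 1 else 0) * ((if b = s' 1 then 1 else 0) *
            ∏ u ∈ Finset.range n, step (s' (u + 1)) (s' (u + 1 + 1))) := by
        intro b
        rw [← chainLaw_cylinder step b n fun u => s' (u + 1)]
        by_cases h : a = s' 0
        · have : consTraj a ⁻¹' {x | ∀ u ≤ n + 1, x u = s' u} =
              {x | ∀ u ≤ n, x u = s' (u + 1)} := by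
            ext x
            simp only [Set.mem_preimage, Set.mem_ofPred_eq]
            constructor
            · intro h u hu; exact h (u + 1) (by omega)
            · intro h' u hu
              cases u with
              | zero => exact h
              | succ u => exact h' u (by omega)
          rw [this, if_pos h, one_mul]
        · have : consTraj a ⁻¹' {x | ∀ u ≤ n + 1, x u = s' u} = ∅ := by
            ext x
            simp only [Set.mem_preimage, Set.mem_ofPred_eq, Set.mem_empty_iff_false, iff_false]
            intro h'; exact h (h' 0 (by omega))
          rw [this, if_neg h, measure_empty, zero_mul]
      simp only [this]
      rw [Finset.prod_range_succ']
      by_cases h : a = s' 0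
      · rw [tsum_eq_single (s' 1) (fun b hb => by simp [hb])]
        simp [h, mul_comm]
      · simp [h]
  obtain ⟨n, hI⟩ : ∃ n, I ⊆ Finset.Iic n :=
    ⟨I.sup id, fun i hi => Finset.mem_Iic.2 (Finset.le_sup (f := id) hi)⟩
  have hc : (I.restrict : (ℕ → S) → _) =
      Finset.restrict₂ (π := fun _ => S) hI ∘ (Finset.Iic n).restrict := rfl
  dsimp only
  rw [hc, ← Measure.map_map (by fun_prop) (by fun_prop), hn n,
    Measure.map_map (by fun_prop) (by fun_prop)]

theorem lintegral_chainLaw (step : S → PMF S) (a : S) {F : (ℕ → S) → ℝ≥0∞} (hF : Measurable F) :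
    ∫⁻ x, F x ∂(chainLaw step a) =
      ∑' b, step a b * ∫⁻ y, F (consTraj a y) ∂(chainLaw step b) := by
  conv_lhs => rw [chainLaw_eq_sum]
  rw [lintegral_sum_measure]
  refine tsum_congr fun b => ?_
  rw [lintegral_smul_measure, lintegral_map hF (measurable_consTraj a), smul_eq_mul]

theorem chainLaw_apply (step : S → PMF S) (a : S) {E : Set (ℕ → S)} (hE : MeasurableSet E) :
    chainLaw step a E = ∑' b, step a b * chainLaw step b (consTraj a ⁻¹' E) := by
  rw [← lintegral_indicator_one hE, lintegral_chainLaw step a (measurable_one.indicator hE)]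
  refine tsum_congr fun b => ?_
  rw [← lintegral_indicator_one (measurable_consTraj a hE)]
  rfl

theorem chainLaw_ae_zero (step : S → PMF S) (a : S) : ∀ᵐ x ∂(chainLaw step a), x 0 = a := by
  have h := chainLaw_cylinder step a 0 fun _ => a
  have hE := measurableSet_cylinder_prefix 0 fun _ : ℕ => a
  simp only [Finset.range_zero, Finset.prod_empty, mul_one, if_true, Nat.le_zero, forall_eq] at h hE
  exact (mem_ae_iff_prob_eq_one hE).2 h

end MarkovChain

/-! ### First times, truncation and first step analysis -/

theorem firstTime_of_zero {E : ℕ → Prop} (h : E 0) : firstTime E = 0 :=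
  le_antisymm ((iInf₂_le (f := fun (t : ℕ) (_ : E t) => (t : ℝ≥0∞)) 0 h).trans_eq Nat.cast_zero)
    bot_le

theorem firstTime_of_not_zero {E : ℕ → Prop} (h : ¬ E 0) :
    firstTime E = 1 + firstTime fun t => E (t + 1) := by
  unfold firstTime
  refine le_antisymm ?_ ?_
  · rw [ENNReal.add_iInf]
    refine le_iInf fun t => ?_
    by_cases ht : E (t + 1)
    · refine (iInf₂_le (t + 1) ht).trans ?_
      simp [ht, add_comm]
    · simp [ht]
  · refine le_iInf₂ fun t ht => ?_
    cases t with
    | zero => exact absurd ht h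
    | succ t =>
      rw [Nat.cast_add, Nat.cast_one, add_comm]
      exact add_le_add_left (iInf₂_le (f := fun t (_ : E (t + 1)) => (t : ℝ≥0∞)) t ht) _

/-- The truncation level drops by one together with the shift of time; this is what makes induction
on the level possible. -/
theorem firstTime_min_succ {E : ℕ → Prop} (h : ¬ E 0) (n : ℕ) :
    min (firstTime E) ((n + 1 : ℕ) : ℝ≥0∞) = 1 + min (firstTime fun t => E (t + 1)) n := by
  rw [firstTime_of_not_zero h, Nat.cast_add, Nat.cast_one, add_comm (n : ℝ≥0∞),
    min_add_add_left]

section MarkovChain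

variable {S : Type*} [MeasurableSpace S]

theorem measurable_firstTime {E : (ℕ → S) → ℕ → Prop} (hE : ∀ t, MeasurableSet {x | E x t}) :
    Measurable fun x => firstTime (E x) := by
  classical
  have : (fun x => firstTime (E x)) = fun x => ⨅ t : ℕ, if E x t then (t : ℝ≥0∞) else ⊤ := by
    funext x
    refine iInf_congr fun t => ?_
    by_cases h : E x t <;> simp [h]
  rw [this]
  exact Measurable.iInf fun t => Measurable.ite (hE t) measurable_const measurable_const

/-- Monotone convergence; the truncation levels have supremum `∞`, so infinite values of `F` are
recovered too. -/
theorem iSup_lintegral_min_natCast {μ : Measure (ℕ → S)} {F : (ℕ → S) → ℝ≥0∞} (hF : Measurable F) :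
    ∫⁻ x, F x ∂μ = ⨆ n : ℕ, ∫⁻ x, min (F x) n ∂μ := by
  rw [← lintegral_iSup (fun n => hF.min measurable_const)]
  · refine lintegral_congr fun x => ?_
    rw [← inf_iSup_eq, ENNReal.iSup_natCast]
    simp
  · intro m n hmn x
    exact min_le_min le_rfl (by exact_mod_cast hmn)

variable [Countable S] [MeasurableSingletonClass S]

/-- The event `E` may depend on the whole trajectory, so that covering all vertices, which is not a
visit of the walk on `V` to a set, is treated along with hitting times. -/
theorem lintegral_min_firstTime_succ (step : S → PMF S) (a : S) {E : (ℕ → S) → ℕ → Prop}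
    (hE : ∀ t, MeasurableSet {x | E x t}) (h : ∀ y, ¬ E (consTraj a y) 0) (n : ℕ) :
    ∫⁻ x, min (firstTime (E x)) ((n + 1 : ℕ) : ℝ≥0∞) ∂(chainLaw step a) =
      1 + ∑' b, step a b *
        ∫⁻ y, min (firstTime fun t => E (consTraj a y) (t + 1)) n ∂(chainLaw step b) := by
  rw [lintegral_chainLaw step a ((measurable_firstTime hE).min measurable_const)]
  simp only [firstTime_min_succ (h _)]
  have : ∀ b, ∫⁻ y, 1 + min (firstTime fun t => E (consTraj a y) (t + 1)) n ∂(chainLaw step b) =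
      1 + ∫⁻ y, min (firstTime fun t => E (consTraj a y) (t + 1)) n ∂(chainLaw step b) := by
    intro b
    rw [lintegral_add_left measurable_const]
    simp
  simp only [this, mul_add, mul_one, ENNReal.tsum_add, PMF.tsum_coe]

theorem lintegral_min_firstTime_eq_zero (step : S → PMF S) (a : S) {E : (ℕ → S) → ℕ → Prop}
    (hE : ∀ t, MeasurableSet {x | E x t}) (h : ∀ y, E (consTraj a y) 0) (n : ℕ) :
    ∫⁻ x, min (firstTime (E x)) n ∂(chainLaw step a) = 0 := by
  rw [lintegral_chainLaw step a ((measurable_firstTime hE).min measurable_const)]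
  simp [firstTime_of_zero (h _)]

/-- The expected number of steps until the first visit to `A`, each trajectory being stopped at
time `n`. -/
def truncHittingTime (step : S → PMF S) (A : Set S) (n : ℕ) (a : S) : ℝ≥0∞ :=
  ∫⁻ x, min (firstTime fun t => x t ∈ A) n ∂(chainLaw step a)

variable (step : S → PMF S) (A : Set S)

theorem measurableSet_visit (A : Set S) (t : ℕ) : MeasurableSet {x : ℕ → S | x t ∈ A} :=
  measurableSet_preimage (measurable_pi_apply t) A.to_countable.measurableSet

theorem iSup_truncHittingTime (a : S) :
    ⨆ n, truncHittingTime step A n a = hittingTime step a A :=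
  (iSup_lintegral_min_natCast (measurable_firstTime (measurableSet_visit A))).symm

theorem truncHittingTime_zero (a : S) : truncHittingTime step A 0 a = 0 := by
  simp [truncHittingTime]

theorem truncHittingTime_of_mem {a : S} (ha : a ∈ A) (n : ℕ) : truncHittingTime step A n a = 0 :=
  lintegral_min_firstTime_eq_zero step a (measurableSet_visit A) (fun _ => ha) n

theorem truncHittingTime_succ {a : S} (ha : a ∉ A) (n : ℕ) :
    truncHittingTime step A (n + 1) a = 1 + ∑' b, step a b * truncHittingTime step A n b :=
  lintegral_min_firstTime_succ step a (measurableSet_visit A) (fun _ => ha) n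

theorem hittingTime_of_mem {a : S} (ha : a ∈ A) : hittingTime step a A = 0 := by
  simp [← iSup_truncHittingTime, truncHittingTime_of_mem step A ha]

/-- First step analysis. -/
theorem hittingTime_of_notMem {a : S} (ha : a ∉ A) :
    hittingTime step a A = 1 + ∑' b, step a b * hittingTime step b A := by
  have hE := measurable_firstTime (measurableSet_visit A)
  unfold hittingTime
  rw [lintegral_chainLaw step a hE]
  have : ∀ b, ∫⁻ y, firstTime (fun t => consTraj a y t ∈ A) ∂(chainLaw step b) =
      1 + ∫⁻ y, firstTime (fun t => y t ∈ A) ∂(chainLaw step b) := by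
    intro b
    have h1 : ∀ y, firstTime (fun t => consTraj a y t ∈ A) = 1 + firstTime (fun t => y t ∈ A) :=
      fun y => firstTime_of_not_zero ha
    simp only [h1]
    rw [lintegral_add_left measurable_const]
    simp
  simp only [this, mul_add, mul_one, ENNReal.tsum_add, PMF.tsum_coe]

/-- Hitting times are the least solution of the equations of first step analysis. -/
theorem hittingTime_le_of_supersolution (g : S → ℝ≥0∞)
    (hg : ∀ a ∉ A, 1 + ∑' b, step a b * g b ≤ g a) (a : S) : hittingTime step a A ≤ g a := by
  rw [← iSup_truncHittingTime]
  refine iSup_le fun n => ?_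
  induction n generalizing a with
  | zero => simp [truncHittingTime_zero]
  | succ n ih =>
    by_cases ha : a ∈ A
    · simp [truncHittingTime_of_mem step A ha]
    · rw [truncHittingTime_succ step A ha]
      refine le_trans ?_ (hg a ha)
      gcongr
      exact ih _

end MarkovChain

theorem PMF.tsum_map_mul {α β : Type*} (p : PMF α) (f : α → β) (g : β → ℝ≥0∞) :
    ∑' b, (p.map f) b * g b = ∑' a, p a * g (f a) := by
  classical
  simp only [PMF.map_apply, ← ENNReal.tsum_mul_right]
  rw [ENNReal.tsum_comm]
  refine tsum_congr fun a => ?_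
  rw [tsum_eq_single (f a) (fun b hb => by simp [hb])]
  simp

/-! ### The cover time as a hitting time -/

namespace WeightedGraph

variable {V : Type*} [Fintype V] [MeasurableSpace V] [MeasurableSingletonClass V] [DecidableEq V]
  (G : WeightedGraph V)

/-- The vertices outside `P` have been visited by time `t`. -/
def CoveredBy (P : Finset V) (x : ℕ → V) (t : ℕ) : Prop := ∀ v, v ∈ P ∨ ∃ u ≤ t, x u = v

omit [DecidableEq V] in
theorem measurableSet_coveredBy (P : Finset V) (t : ℕ) : MeasurableSet {x | CoveredBy P x t} := by
  have : {x : ℕ → V | CoveredBy P x t} =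
      ⋂ v, ({x | v ∈ P} ∪ ⋃ u, ⋃ (_ : u ≤ t), (fun x : ℕ → V => x u) ⁻¹' {v}) := by
    ext x; simp [CoveredBy]
  rw [this]
  exact MeasurableSet.iInter fun v => (MeasurableSet.const _).union <| MeasurableSet.iUnion fun u =>
    MeasurableSet.iUnion fun _ => measurable_pi_apply u (measurableSet_singleton _)

-- Time `0` counts as a visit, so recording the starting vertex in advance makes no difference. This
-- mirrors the update of the visited set in `assocStep`.
omit [Fintype V] [MeasurableSpace V] [MeasurableSingletonClass V] in
theorem coveredBy_insert {P : Finset V} {x : ℕ → V} {j : V} (h : x 0 = j) :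
    CoveredBy (insert j P) x = CoveredBy P x := by
  funext t
  refine propext (forall_congr' fun v => ?_)
  rw [Finset.mem_insert]
  constructor
  · rintro ((rfl | h') | h')
    · exact Or.inr ⟨0, Nat.zero_le _, h⟩
    · exact Or.inl h'
    · exact Or.inr h'
  · rintro (h' | h')
    · exact Or.inl (Or.inr h')
    · exact Or.inr h'

omit [Fintype V] [MeasurableSpace V] [MeasurableSingletonClass V] [DecidableEq V] in
theorem coveredBy_consTraj_zero {P : Finset V} {i : V} (hi : i ∈ P) (y : ℕ → V) :
    CoveredBy P (consTraj i y) 0 ↔ ∀ v, v ∈ P := by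
  refine forall_congr' fun v => or_iff_left_of_imp ?_
  rintro ⟨u, hu, rfl⟩
  obtain rfl := Nat.le_zero.1 hu
  exact hi

omit [Fintype V] [MeasurableSpace V] [MeasurableSingletonClass V] [DecidableEq V] in
theorem coveredBy_consTraj_succ {P : Finset V} {i : V} (hi : i ∈ P) (y : ℕ → V) (t : ℕ) :
    CoveredBy P (consTraj i y) (t + 1) ↔ CoveredBy P y t := by
  refine forall_congr' fun v => ?_
  constructor
  · rintro (h | ⟨u, hu, h⟩)
    · exact Or.inl h
    · cases u with
      | zero => exact Or.inl (h ▸ hi)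
      | succ u => exact Or.inr ⟨u, by omega, h⟩
  · rintro (h | ⟨u, hu, h⟩)
    · exact Or.inl h
    · exact Or.inr ⟨u + 1, by omega, h⟩

omit [MeasurableSpace V] [MeasurableSingletonClass V] in
theorem tsum_assocStep_mul (P : Finset V) (i : V) (g : Finset V × V → ℝ≥0∞) :
    ∑' y, G.assocStep (P, i) y * g y = ∑ j, G.step i j * g (insert j P, j) := by
  rw [← tsum_fintype (L := .unconditional V), assocStep, PMF.tsum_map_mul]

/-- Both sides satisfy the same recurrence in `n`. The set has to vary in the induction because a
step to `j` replaces it by `insert j P`, which contains the new position. -/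
theorem lintegral_min_firstTime_coveredBy (n : ℕ) (P : Finset V) {i : V} (hi : i ∈ P) :
    ∫⁻ x, min (firstTime (CoveredBy P x)) n ∂(chainLaw G.step i) =
      truncHittingTime G.assocStep (covered V) n (P, i) := by
  induction n generalizing P i with
  | zero => simp [truncHittingTime_zero]
  | succ n ih =>
    by_cases hP : P = Finset.univ
    · rw [truncHittingTime_of_mem _ _ (show (P, i) ∈ covered V from hP),
        lintegral_min_firstTime_eq_zero _ _ (measurableSet_coveredBy P)]
      intro y
      rw [coveredBy_consTraj_zero hi, hP]
      exact Finset.mem_univ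
    · rw [truncHittingTime_succ _ _ (show (P, i) ∉ covered V from hP),
        lintegral_min_firstTime_succ _ _ (measurableSet_coveredBy P), tsum_assocStep_mul,
        tsum_fintype]
      · congr 1
        refine Finset.sum_congr rfl fun j _ => ?_
        rw [← ih (insert j P) (Finset.mem_insert_self _ _)]
        congr 1
        refine lintegral_congr_ae ?_
        filter_upwards [chainLaw_ae_zero G.step j] with x hx
        simp only [coveredBy_consTraj_succ hi, coveredBy_insert hx]
      · intro y h
        rw [coveredBy_consTraj_zero hi] at h
        exact hP (Finset.eq_univ_iff_forall.2 h)

/-- The cover time is a hitting time in the associated graph. -/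
theorem coverTime_eq_hitCovered (i : V) : G.coverTime i = G.hitCovered {i} i := by
  have h1 : G.coverTime i = ∫⁻ x, firstTime (CoveredBy {i} x) ∂(chainLaw G.step i) := by
    refine lintegral_congr_ae ?_
    filter_upwards [chainLaw_ae_zero G.step i] with x hx
    -- Almost surely the walk is at `i` at time `0`, so `{i} = insert i ∅` may be replaced by `∅`,
    -- for which `CoveredBy` is covering in the literal sense.
    rw [← insert_empty_eq, coveredBy_insert hx]
    refine congrArg firstTime (funext fun t => propext (forall_congr' fun v => ?_))
    simp
  rw [h1, iSup_lintegral_min_natCast (measurable_firstTime (measurableSet_coveredBy {i})),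
    hitCovered, ← iSup_truncHittingTime]
  exact iSup_congr fun n => G.lintegral_min_firstTime_coveredBy n {i} (Finset.mem_singleton_self i)

theorem hitCovered_univ (i : V) : G.hitCovered Finset.univ i = 0 :=
  hittingTime_of_mem _ _ rfl

theorem hitCovered_eq {P : Finset V} (hP : P ≠ Finset.univ) (i : V) :
    G.hitCovered P i = 1 + ∑ j, G.step i j * G.hitCovered (insert j P) j := by
  rw [hitCovered, hittingTime_of_notMem _ _ (show (P, i) ∉ covered V from hP), tsum_assocStep_mul]
  rfl

end WeightedGraph

/-! ### Exit times and stay times -/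

theorem firstTime_exit_eq {S : Type*} {P : Set S} {x : ℕ → S} (h0 : x 0 ∈ P) :
    firstTime (fun t => x t ∉ P) = 1 + (({t : ℕ | ∀ u ≤ t + 1, x u ∈ P}.encard : ℕ∞) : ℝ≥0∞) := by
  classical
  by_cases h : ∃ t, x t ∉ P
  · have hT := Nat.find_spec h
    have hmin : ∀ u, u < Nat.find h → x u ∈ P := fun u hu => not_not.1 (Nat.find_min h hu)
    obtain ⟨T, hTT⟩ : ∃ T, Nat.find h = T + 1 :=
      Nat.exists_eq_succ_of_ne_zero fun h' => by rw [h'] at hT; exact hT h0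
    rw [hTT] at hT hmin
    have h1 : firstTime (fun t => x t ∉ P) = ((T + 1 : ℕ) : ℝ≥0∞) := by
      refine le_antisymm (iInf₂_le (f := fun (t : ℕ) (_ : x t ∉ P) => (t : ℝ≥0∞)) (T + 1) hT) ?_
      refine le_iInf₂ fun t ht => ?_
      by_contra hlt
      exact ht (hmin t (by simpa only [not_le, Nat.cast_lt] using hlt))
    -- A first exit at time `T + 1` is preceded by exactly the `T` inner steps begun at times `0, …,
    -- T - 1`; the exiting step is the summand `1`.
    have h2 : {t : ℕ | ∀ u ≤ t + 1, x u ∈ P} = (Finset.range T : Set ℕ) := by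
      ext t
      simp only [Set.mem_ofPred_eq, Finset.coe_range, Set.mem_Iio]
      constructor
      · intro h'
        by_contra hlt
        exact hT (h' (T + 1) (by omega))
      · intro ht u hu
        exact hmin u (by omega)
    rw [h1, h2, Set.encard_coe_eq_coe_finsetCard, Finset.card_range]
    simp [add_comm]
  · push Not at h
    have h1 : firstTime (fun t => x t ∉ P) = ⊤ := by simp [firstTime, h]
    have h2 : {t : ℕ | ∀ u ≤ t + 1, x u ∈ P} = Set.univ := by ext; simp [h]
    rw [h1, h2]
    simp

/-! ### The boundary value problem for the weighted Laplacian -/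

namespace WeightedGraph

variable {V : Type*} (G : WeightedGraph V)

theorem weight_nonneg (i j : V) : 0 ≤ G.weight i j := by
  by_cases h : G.graph.Adj i j
  · exact (G.weight_pos i j h).le
  · exact (G.weight_eq_zero i j h).ge

theorem weight_self (i : V) : G.weight i i = 0 := G.weight_eq_zero i i (G.graph.loopless.irrefl i)

variable [Fintype V]

/-- The net current out of the vertex `k` under the potential `φ`. -/
def laplacian (φ : V → ℝ) (k : V) : ℝ := ∑ l, G.weight k l * (φ k - φ l)

theorem laplacian_eq (φ : V → ℝ) (k : V) :
    G.laplacian φ k = (∑ l, G.weight k l) * φ k - ∑ l, G.weight k l * φ l := by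
  simp only [laplacian, mul_sub, Finset.sum_sub_distrib, Finset.sum_mul]

variable {G} (hG : G.graph.Connected) {P : Finset V} (hP : P ≠ Finset.univ)

include hG hP

/-- The minimum principle for superharmonic functions. -/
theorem nonneg_of_laplacian_nonneg {φ : V → ℝ} (h1 : ∀ k ∈ P, 0 ≤ G.laplacian φ k)
    (h2 : ∀ k ∉ P, 0 ≤ φ k) (k : V) : 0 ≤ φ k := by
  by_contra hk
  obtain ⟨m, -, hm⟩ := Finset.exists_min_image Finset.univ φ ⟨k, Finset.mem_univ k⟩
  have hm0 : φ m < 0 := (hm k (Finset.mem_univ k)).trans_lt (not_le.1 hk)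
  -- At a vertex of `P` attaining the negative minimum, all summands of the Laplacian are
  -- nonpositive and their sum is nonnegative. So all vanish, and the minimum spreads along edges
  -- until it reaches a vertex outside `P`, where `φ` is nonnegative.
  have hadj : ∀ a b, G.graph.Adj a b → φ a = φ m → φ b = φ m := by
    intro a b hab ha
    have haP : a ∈ P := by
      by_contra haP
      linarith [h2 a haP]
    have hterm : ∀ l ∈ Finset.univ, G.weight a l * (φ a - φ l) ≤ 0 := fun l hl =>
      mul_nonpos_of_nonneg_of_nonpos (G.weight_nonneg a l) (by rw [ha]; linarith [hm l hl])
    have hsum : ∑ l, G.weight a l * (φ a - φ l) = 0 :=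
      le_antisymm (Finset.sum_nonpos hterm) (h1 a haP)
    have := (Finset.sum_eq_zero_iff_of_nonpos hterm).1 hsum b (Finset.mem_univ b)
    rcases mul_eq_zero.1 this with h | h
    · exact absurd h (G.weight_pos a b hab).ne'
    · linarith
  have hall : ∀ v, φ v = φ m := by
    intro v
    obtain ⟨w⟩ := hG.preconnected m v
    have : ∀ {a b : V} (w : G.graph.Walk a b), φ a = φ m → φ b = φ m := by
      intro a b w
      induction w with
      | nil => exact id
      | cons h _ ih => exact fun h' => ih (hadj _ _ h h')
    exact this w rfl
  obtain ⟨v, hv⟩ : ∃ v, v ∉ P := by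
    by_contra h
    push Not at h
    exact hP (Finset.eq_univ_iff_forall.2 h)
  linarith [h2 v hv, hall v]

theorem eq_zero_of_laplacian_eq_zero {φ : V → ℝ} (h1 : ∀ k ∈ P, G.laplacian φ k = 0)
    (h2 : ∀ k ∉ P, φ k = 0) : φ = 0 := by
  funext k
  refine le_antisymm ?_ (nonneg_of_laplacian_nonneg hG hP (fun k hk => (h1 k hk).ge)
    (fun k hk => (h2 k hk).ge) k)
  have := nonneg_of_laplacian_nonneg hG hP (φ := fun k => - φ k) (fun k hk => ?_)
    (fun k hk => by simp [h2 k hk]) k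
  · simpa using this
  · have : G.laplacian (fun k => - φ k) k = - G.laplacian φ k := by
      simp only [laplacian, ← Finset.sum_neg_distrib]
      exact Finset.sum_congr rfl fun l _ => by ring
    rw [this, h1 k hk, neg_zero]

theorem eq_of_laplacian_eq {φ ψ : V → ℝ} (h1 : ∀ k ∈ P, G.laplacian φ k = G.laplacian ψ k)
    (h2 : ∀ k ∉ P, φ k = ψ k) : φ = ψ := by
  have h := eq_zero_of_laplacian_eq_zero hG hP (φ := φ - ψ) (fun k hk => ?_)
    (fun k hk => by simp [h2 k hk])
  · exact sub_eq_zero.1 h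
  · have : G.laplacian (φ - ψ) k = G.laplacian φ k - G.laplacian ψ k := by
      simp only [laplacian, ← Finset.sum_sub_distrib, Pi.sub_apply]
      exact Finset.sum_congr rfl fun l _ => by ring
    rw [this, h1 k hk, sub_self]

-- Uniqueness is injectivity of a linear endomorphism of `V → ℝ`, whose rows outside `P` are those
-- of the identity; in finite dimension it is then surjective.
open Classical in
theorem exists_laplacian_eq (r : V → ℝ) :
    ∃ φ : V → ℝ, (∀ k ∈ P, G.laplacian φ k = r k) ∧ ∀ k ∉ P, φ k = 0 := by
  let L : (V → ℝ) →ₗ[ℝ] (V → ℝ) :=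
    { toFun := fun φ k => if k ∈ P then G.laplacian φ k else φ k
      map_add' := fun φ ψ => by
        funext k
        by_cases hk : k ∈ P
        · simp only [hk, if_true, laplacian, Pi.add_apply, ← Finset.sum_add_distrib]
          exact Finset.sum_congr rfl fun l _ => by ring
        · simp [hk]
      map_smul' := fun c φ => by
        funext k
        by_cases hk : k ∈ P
        · simp only [hk, if_true, laplacian, Pi.smul_apply, smul_eq_mul, RingHom.id_apply,
            Finset.mul_sum]
          exact Finset.sum_congr rfl fun l _ => by ring
        · simp [hk] }
  have hL : ∀ φ k, L φ k = if k ∈ P then G.laplacian φ k else φ k := fun _ _ => rfl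
  have hinj : Function.Injective L := by
    rw [injective_iff_map_eq_zero]
    intro φ hφ
    refine eq_zero_of_laplacian_eq_zero hG hP (fun k hk => ?_) (fun k hk => ?_)
    · simpa [hL, hk] using congrFun hφ k
    · simpa [hL, hk] using congrFun hφ k
  obtain ⟨φ, hφ⟩ := LinearMap.injective_iff_surjective.1 hinj fun k => if k ∈ P then r k else 0
  refine ⟨φ, fun k hk => ?_, fun k hk => ?_⟩
  · simpa [hL, hk] using congrFun hφ k
  · simpa [hL, hk] using congrFun hφ k

/-- A path from `k` to a vertex outside `P` has a first edge. This excludes the isolated vertex, for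
which `step` has a default value. -/
theorem degree_pos {k : V} (hk : k ∈ P) : 0 < ∑ l, G.weight k l := by
  obtain ⟨v, hv⟩ : ∃ v, v ∉ P := by
    by_contra h
    push Not at h
    exact hP (Finset.eq_univ_iff_forall.2 h)
  have hkv : k ≠ v := fun h => hv (h ▸ hk)
  obtain ⟨w⟩ := hG.preconnected k v
  cases w with
  | nil => exact absurd rfl hkv
  | @cons _ l _ h _ =>
    exact Finset.sum_pos' (fun l _ => G.weight_nonneg k l) ⟨l, Finset.mem_univ l, G.weight_pos k l h⟩

theorem step_eq {k : V} (hk : k ∈ P) (l : V) :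
    G.step k l = ENNReal.ofReal (G.weight k l / ∑ l, G.weight k l) := by
  have hd := degree_pos hG hP hk
  have hs : ∑' j, ENNReal.ofReal (G.weight k j) = ENNReal.ofReal (∑ l, G.weight k l) := by
    rw [tsum_fintype, ENNReal.ofReal_sum_of_nonneg fun l _ => G.weight_nonneg k l]
  have h0 : ∑' j, ENNReal.ofReal (G.weight k j) ≠ 0 := by
    rw [hs]; simpa using hd
  rw [step, dif_neg h0, PMF.normalize_apply, hs, ENNReal.ofReal_div_of_pos hd, div_eq_mul_inv]

/-- The equations of first step analysis as Kirchhoff's current law. -/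
theorem laplacian_toReal {u : V → ℝ≥0∞} {c : ℝ≥0∞} (hu : ∀ l, u l ≠ ∞) (hc : c ≠ ∞) {k : V}
    (hk : k ∈ P) (h : u k = c + ∑ l, G.step k l * u l) :
    G.laplacian (fun l => (u l).toReal) k = c.toReal * ∑ l, G.weight k l := by
  have hd := degree_pos hG hP hk
  have hfin : ∀ l ∈ Finset.univ, G.step k l * u l ≠ ∞ := fun l _ =>
    ENNReal.mul_ne_top (PMF.apply_ne_top _ _) (hu l)
  have h1 : (u k).toReal =
      c.toReal + (∑ l, G.weight k l * (u l).toReal) / ∑ l, G.weight k l := by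
    rw [h, ENNReal.toReal_add hc (ENNReal.sum_ne_top.2 hfin), ENNReal.toReal_sum hfin,
      Finset.sum_div]
    congr 1
    refine Finset.sum_congr rfl fun l _ => ?_
    rw [ENNReal.toReal_mul, step_eq hG hP hk, ENNReal.toReal_ofReal
      (div_nonneg (G.weight_nonneg k l) hd.le)]
    ring
  rw [laplacian_eq, h1]
  field_simp
  ring

/-! ### Finiteness of exit times, and exit probabilities -/

variable [MeasurableSpace V] [MeasurableSingletonClass V]

/-- The solution of `Δφ(k) = ω(k)` on `P` with zero boundary values is nonnegative by the minimum
principle. It solves the first step equations of the exit time, whose least solution is the exit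
time itself. -/
theorem hittingTime_ne_top (i : V) : hittingTime G.step i {v | v ∉ P} ≠ ∞ := by
  obtain ⟨φ, h1, h2⟩ := exists_laplacian_eq hG hP fun k => ∑ l, G.weight k l
  have h0 : ∀ k, 0 ≤ φ k := nonneg_of_laplacian_nonneg hG hP
    (fun k hk => (h1 k hk).symm ▸ (degree_pos hG hP hk).le) (fun k hk => (h2 k hk).ge)
  refine ne_top_of_le_ne_top (b := ENNReal.ofReal (φ i)) ENNReal.ofReal_ne_top
    (hittingTime_le_of_supersolution G.step _ (fun k => ENNReal.ofReal (φ k)) (fun k hk => ?_) i)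
  have hk : k ∈ P := not_not.1 hk
  have hd := degree_pos hG hP hk
  have hw : ∀ l, 0 ≤ G.weight k l / ∑ l, G.weight k l := fun l =>
    div_nonneg (G.weight_nonneg k l) hd.le
  rw [tsum_fintype]
  simp only [step_eq hG hP hk, ← ENNReal.ofReal_mul (hw _)]
  rw [← ENNReal.ofReal_sum_of_nonneg fun l _ => mul_nonneg (hw l) (h0 l), ← ENNReal.ofReal_one,
    ← ENNReal.ofReal_add zero_le_one (Finset.sum_nonneg fun l _ => mul_nonneg (hw l) (h0 l))]
  refine ENNReal.ofReal_le_ofReal (le_of_eq ?_)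
  have := h1 k hk
  rw [laplacian_eq] at this
  have h3 : ∑ l, G.weight k l / (∑ l, G.weight k l) * φ l =
      (∑ l, G.weight k l * φ l) / ∑ l, G.weight k l := by
    rw [Finset.sum_div]
    exact Finset.sum_congr rfl fun l _ => by ring
  rw [h3]
  field_simp
  linarith

omit hG hP

omit [Fintype V] in
theorem measurableSet_exit [Countable V] (P : Finset V) (j : V) :
    MeasurableSet {x : ℕ → V | ∃ t, (∀ u < t, x u ∈ P) ∧ x t ∉ P ∧ x t = j} := by
  have : {x : ℕ → V | ∃ t, (∀ u < t, x u ∈ P) ∧ x t ∉ P ∧ x t = j} =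
      ⋃ t, ((⋂ u, ⋂ (_ : u < t), {x | x u ∈ (P : Set V)}) ∩ ({x | x t ∈ {v | v ∉ P}} ∩
        {x | x t ∈ ({j} : Set V)})) := by
    ext x; simp
  rw [this]
  exact MeasurableSet.iUnion fun t => (MeasurableSet.iInter fun u => MeasurableSet.iInter fun _ =>
    measurableSet_visit _ u).inter ((measurableSet_visit _ t).inter (measurableSet_visit _ t))

/-- A trajectory starting in `P` and its tail leave `P` at the same vertex. -/
theorem exitProb_of_mem {k : V} (hk : k ∈ P) (j : V) :
    G.exitProb P k j = ∑ l, G.step k l * G.exitProb P l j := by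
  unfold exitProb
  rw [chainLaw_apply _ _ (measurableSet_exit P j), tsum_fintype]
  refine Finset.sum_congr rfl fun l _ => ?_
  congr 2
  ext x
  constructor
  · rintro ⟨t, h1, h2, h3⟩
    cases t with
    | zero => exact absurd hk h2
    | succ t => exact ⟨t, fun u hu => h1 (u + 1) (by omega), h2, h3⟩
  · rintro ⟨t, h1, h2, h3⟩
    refine ⟨t + 1, fun u hu => ?_, h2, h3⟩
    cases u with
    | zero => exact hk
    | succ u => exact h1 u (by omega)

open Classical in
theorem exitProb_of_notMem {k : V} (hk : k ∉ P) (j : V) :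
    G.exitProb P k j = if k = j then 1 else 0 := by
  unfold exitProb
  have : ∀ᵐ x ∂(chainLaw G.step k),
      x ∈ {x : ℕ → V | ∃ t, (∀ u < t, x u ∈ P) ∧ x t ∉ P ∧ x t = j} ↔ x ∈ {_x : ℕ → V | k = j} := by
    filter_upwards [chainLaw_ae_zero G.step k] with x hx
    constructor
    · rintro ⟨t, h1, h2, h3⟩
      cases t with
      | zero => exact hx.symm.trans h3
      | succ t => exact absurd (hx ▸ h1 0 (by omega)) hk
    · intro h
      exact ⟨0, fun u hu => absurd hu (Nat.not_lt_zero u), hx.symm ▸ hk, hx.trans h⟩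
  rw [measure_congr (Filter.eventuallyEq_set.2 this)]
  by_cases h : k = j <;> simp [h]

theorem exitProb_ne_top (k j : V) : G.exitProb P k j ≠ ∞ := measure_ne_top _ _

theorem hittingTime_compl_eq {i : V} (hi : i ∈ P) :
    hittingTime G.step i {v | v ∉ P} = 1 + G.stayTime P i := by
  have h : hittingTime G.step i {v | v ∉ P} = ∫⁻ x,
      1 + (({t : ℕ | ∀ u ≤ t + 1, x u ∈ P}.encard : ℕ∞) : ℝ≥0∞) ∂(chainLaw G.step i) := by
    refine lintegral_congr_ae ?_
    filter_upwards [chainLaw_ae_zero G.step i] with x hx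
    exact firstTime_exit_eq (P := (P : Set V)) (x := x) (by rw [hx]; exact hi)
  rw [h, lintegral_add_left measurable_const, stayTime]
  simp

include hG in
/-- Exit probabilities are potentials. -/
theorem isPotential_iff {j : V} (hj : j ∉ P) (φ : V → ℝ) :
    G.IsPotential P j φ ↔ φ = fun i => (G.exitProb P i j).toReal := by
  have hP : P ≠ Finset.univ := fun h => hj (h ▸ Finset.mem_univ j)
  have h1 : ∀ k ∈ P, G.laplacian (fun i => (G.exitProb P i j).toReal) k = 0 := fun k hk => by
    rw [laplacian_toReal hG hP (c := 0) (fun l => exitProb_ne_top l j) ENNReal.zero_ne_top hk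
      (by rw [zero_add]; exact exitProb_of_mem hk j), ENNReal.toReal_zero, zero_mul]
  constructor
  · rintro ⟨hφ1, hφ2, hφ3⟩
    refine eq_of_laplacian_eq hG hP (fun k hk => (hφ3 k hk).trans (h1 k hk).symm) fun k hk => ?_
    by_cases hkj : k = j
    · rw [exitProb_of_notMem hk, if_pos hkj, hkj, hφ1, ENNReal.toReal_one]
    · simp [exitProb_of_notMem hk, hkj, hφ2 k hk hkj]
  · rintro rfl
    exact ⟨by simp [exitProb_of_notMem hj], fun k hk hkj => by simp [exitProb_of_notMem hk, hkj], h1⟩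

/-! ### The recursion over visited sets -/

variable [DecidableEq V]

/-- The expected value of `∑ⱼ p(P,k,j) c(j)` plus the exit time, from first step analysis. -/
theorem exit_decomposition_of_mem (c : V → ℝ≥0∞) {k : V} (hk : k ∈ P) :
    hittingTime G.step k {v | v ∉ P} + ∑ j ∈ Pᶜ, G.exitProb P k j * c j =
      1 + ∑ l, G.step k l *
        (hittingTime G.step l {v | v ∉ P} + ∑ j ∈ Pᶜ, G.exitProb P l j * c j) := by
  rw [hittingTime_of_notMem G.step {v | v ∉ P} (a := k) (not_not.2 hk), tsum_fintype, add_assoc]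
  simp only [mul_add, Finset.sum_add_distrib, exitProb_of_mem hk, Finset.sum_mul, Finset.mul_sum,
    mul_assoc]
  rw [Finset.sum_comm]

theorem exit_decomposition_of_notMem (c : V → ℝ≥0∞) {k : V} (hk : k ∉ P) :
    hittingTime G.step k {v | v ∉ P} + ∑ j ∈ Pᶜ, G.exitProb P k j * c j = c k := by
  rw [hittingTime_of_mem G.step {v | v ∉ P} (a := k) hk, zero_add,
    Finset.sum_eq_single_of_mem k (Finset.mem_compl.2 hk)]
  · simp [exitProb_of_notMem hk]
  · intro j _ hjk
    simp [exitProb_of_notMem hk, hjk.symm]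

/-- An a priori bound by induction on the truncation level, valid with infinite values. It supplies
the finiteness without which the first step equations cannot be read as real linear equations. -/
theorem hitCovered_le_exit_decomposition {k : V} (hk : k ∈ P) (hP : P ≠ Finset.univ) :
    G.hitCovered P k ≤ hittingTime G.step k {v | v ∉ P} +
      ∑ j ∈ Pᶜ, G.exitProb P k j * G.hitCovered (insert j P) j := by
  rw [hitCovered, ← iSup_truncHittingTime]
  refine iSup_le fun n => ?_
  induction n generalizing k with
  | zero => simp [truncHittingTime_zero]
  | succ n ih =>
    rw [truncHittingTime_succ _ _ (show (P, k) ∉ covered V from hP), tsum_assocStep_mul,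
      exit_decomposition_of_mem (fun j => G.hitCovered (insert j P) j) hk]
    gcongr with l
    by_cases hl : l ∈ P
    · rw [Finset.insert_eq_of_mem hl]
      exact ih hl
    -- At a new vertex the bound is the full hitting time from `(insert l P, l)`, which dominates
    -- its truncation.
    · rw [exit_decomposition_of_notMem (fun j => G.hitCovered (insert j P) j) hl, hitCovered,
        ← iSup_truncHittingTime]
      exact le_iSup (fun n => truncHittingTime G.assocStep (covered V) n (insert l P, l)) n

include hG hP

/-- Writing `insert k P` for every `k` unites the unknowns (`k ∈ P`) and the boundary values (`k ∉
P`) in a single function on `V`, to which uniqueness applies. -/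
theorem hitCovered_recursion_of_ne_top
    (hfin : ∀ j ∉ P, G.hitCovered (insert j P) j ≠ ∞) {k : V} (hk : k ∈ P) :
    G.hitCovered P k ≠ ∞ ∧ G.hitCovered P k = hittingTime G.step k {v | v ∉ P} +
      ∑ j ∈ Pᶜ, G.exitProb P k j * G.hitCovered (insert j P) j := by
  set g : V → ℝ≥0∞ := fun k => hittingTime G.step k {v | v ∉ P} +
    ∑ j ∈ Pᶜ, G.exitProb P k j * G.hitCovered (insert j P) j with hg
  have hgfin : ∀ k, g k ≠ ∞ := fun k => ENNReal.add_ne_top.2 ⟨hittingTime_ne_top hG hP k,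
    ENNReal.sum_ne_top.2 fun j hj => ENNReal.mul_ne_top (exitProb_ne_top k j)
      (hfin j (Finset.mem_compl.1 hj))⟩
  have hffin : ∀ k, G.hitCovered (insert k P) k ≠ ∞ := fun k => by
    by_cases hk : k ∈ P
    · rw [Finset.insert_eq_of_mem hk]
      exact ne_top_of_le_ne_top (hgfin k) (hitCovered_le_exit_decomposition hk hP)
    · exact hfin k hk
  have h := eq_of_laplacian_eq hG hP (φ := fun k => (G.hitCovered (insert k P) k).toReal)
    (ψ := fun k => (g k).toReal) (fun k hk => ?_) (fun k hk => ?_)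
  · have h' := congrFun h k
    have hk' := hffin k
    rw [Finset.insert_eq_of_mem hk] at h' hk'
    exact ⟨hk', (ENNReal.toReal_eq_toReal_iff' hk' (hgfin k)).1 h'⟩
  · rw [laplacian_toReal hG hP hffin ENNReal.one_ne_top hk
        (by rw [Finset.insert_eq_of_mem hk]; exact hitCovered_eq G hP k),
      laplacian_toReal hG hP hgfin ENNReal.one_ne_top hk (exit_decomposition_of_mem _ hk)]
  · simp only [hg, exit_decomposition_of_notMem (fun j => G.hitCovered (insert j P) j) hk]

omit hP

theorem hitCovered_ne_top {k : V} (hk : k ∈ P) : G.hitCovered P k ≠ ∞ := by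
  induction h : Pᶜ.card generalizing P k with
  | zero =>
    rw [Finset.card_eq_zero, Finset.compl_eq_empty_iff] at h
    rw [h, hitCovered_univ]
    exact ENNReal.zero_ne_top
  | succ m ih =>
    have hP : P ≠ Finset.univ := by
      rintro rfl
      simp at h
    refine (hitCovered_recursion_of_ne_top hG hP (fun j hj => ?_) hk).1
    refine ih (Finset.mem_insert_self j P) ?_
    rw [Finset.compl_insert, Finset.card_erase_of_mem (Finset.mem_compl.2 hj), h]
    rfl

include hP

theorem hitCovered_recursion {k : V} (hk : k ∈ P) :
    G.hitCovered P k = 1 + G.stayTime P k +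
      ∑ j ∈ Pᶜ, G.exitProb P k j * G.hitCovered (insert j P) j := by
  rw [← hittingTime_compl_eq hk]
  exact (hitCovered_recursion_of_ne_top hG hP
    (fun j _ => hitCovered_ne_top hG (Finset.mem_insert_self j P)) hk).2

end WeightedGraph

/-! ### Gauss–Jordan elimination without pivoting -/

/-- One step of the elimination: multiples of row `k` are subtracted from all other rows so that
column `k` becomes zero outside the diagonal. -/
def elimStep (k : ℕ) (M : ℕ → ℕ → ℝ) (i l : ℕ) : ℝ :=
  M i l - (if i = k then 0 else M i k / M k k) * M k l

/-- The diagonal is not normalised, so solutions are quotients by diagonal entries. Columns from `n`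
on are transformed too; column `n` carries the right-hand side. -/
def elim (M : ℕ → ℕ → ℝ) : ℕ → ℕ → ℕ → ℝ
  | 0 => M
  | k + 1 => elimStep k (elim M k)

theorem elimStep_self_row (k : ℕ) (M : ℕ → ℕ → ℝ) (l : ℕ) : elimStep k M k l = M k l := by
  simp [elimStep]

theorem sum_elimStep (n k : ℕ) (M : ℕ → ℕ → ℝ) (i : ℕ) (x : ℕ → ℝ) :
    ∑ l ∈ Finset.range n, elimStep k M i l * x l =
      (∑ l ∈ Finset.range n, M i l * x l) -
        (if i = k then 0 else M i k / M k k) * ∑ l ∈ Finset.range n, M k l * x l := by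
  rw [Finset.mul_sum, ← Finset.sum_sub_distrib]
  exact Finset.sum_congr rfl fun l _ => by rw [elimStep]; ring

section

variable {n : ℕ} {M : ℕ → ℕ → ℝ}

/-- The leading principal submatrices of `M` are nonsingular. -/
def LeadingRegular (n : ℕ) (M : ℕ → ℕ → ℝ) : Prop :=
  ∀ k < n, ∀ x : ℕ → ℝ, (∀ l, k < l → x l = 0) →
    (∀ i ≤ k, ∑ l ∈ Finset.range n, M i l * x l = 0) → x k = 0

/-- The state of the elimination before step `k`: the first `k` columns are diagonal, and the
leading blocks of rows have no more solutions than at the beginning. -/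
structure Reduced (n : ℕ) (M : ℕ → ℕ → ℝ) (k : ℕ) : Prop where
  off_diag : ∀ i l, l < k → i ≠ l → elim M k i l = 0
  diag : ∀ l < k, elim M k l l ≠ 0
  kernel : ∀ m < n, k ≤ m + 1 → ∀ x : ℕ → ℝ,
    (∀ i ≤ m, ∑ l ∈ Finset.range n, elim M k i l * x l = 0) →
    ∀ i ≤ m, ∑ l ∈ Finset.range n, M i l * x l = 0

/-- A zero pivot would give a vector with `x k = 1`, supported on indices up to `k` and annihilated
by rows `0, …, k`; by `kernel` the same rows of `M` would annihilate it. -/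
theorem Reduced.pivot_ne_zero (hM : LeadingRegular n M) {k : ℕ} (hk : k < n) (h : Reduced n M k) :
    elim M k k k ≠ 0 := by
  intro h0
  -- Columns before `k` are already diagonal, so the choice `x k = 1` determines the entries before
  -- it.
  let x : ℕ → ℝ := fun l =>
    if l < k then - elim M k l k / elim M k l l else if l = k then 1 else 0
  have hxk : x k = 1 := by simp [x]
  have hx : ∀ l, k < l → x l = 0 := fun l hl => by
    simp [x, hl.not_gt, hl.ne']
  have := hM k hk x hx (h.kernel k hk (by omega) x fun i hi => ?_)
  · rw [hxk] at this; exact one_ne_zero this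
  · rcases Nat.lt_or_eq_of_le hi with hi | rfl
    · rw [Finset.sum_eq_add_of_mem i k (Finset.mem_range.2 (by omega)) (Finset.mem_range.2 hk)
        hi.ne]
      · have hxi : x i = - elim M k i k / elim M k i i := by simp [x, hi]
        rw [hxk, hxi]
        have := h.diag i hi
        field_simp
        ring
      · rintro l - ⟨hl1, hl2⟩
        rcases lt_or_gt_of_ne hl2 with hl | hl
        · rw [h.off_diag i l hl (Ne.symm hl1), zero_mul]
        · rw [hx l hl, mul_zero]
    · refine Finset.sum_eq_zero fun l _ => ?_
      rcases lt_trichotomy l i with hl | rfl | hl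
      · rw [h.off_diag i l hl hl.ne', zero_mul]
      · rw [h0, zero_mul]
      · rw [hx l hl, mul_zero]

theorem LeadingRegular.reduced (hM : LeadingRegular n M) {k : ℕ} (hk : k ≤ n) : Reduced n M k := by
  induction k with
  | zero => exact ⟨by simp, by simp, fun m _ _ x hx => hx⟩
  | succ k ih =>
    have h := ih (by omega)
    have h4 := h.pivot_ne_zero hM hk
    refine ⟨fun i l hl hil => ?_, fun l hl => ?_, fun m hm hkm x hx => ?_⟩
    · rcases Nat.lt_succ_iff_lt_or_eq.1 hl with hl | rfl
      · by_cases hik : i = k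
        · rw [elim, hik, elimStep_self_row, h.off_diag k l hl hl.ne']
        · rw [elim, elimStep, h.off_diag i l hl hil, h.off_diag k l hl hl.ne', mul_zero, sub_zero]
      · rw [elim, elimStep, if_neg hil, div_mul_cancel₀ _ h4, sub_self]
    · rcases Nat.lt_succ_iff_lt_or_eq.1 hl with hl | rfl
      · rw [elim, elimStep, h.off_diag k l hl hl.ne', mul_zero, sub_zero]
        exact h.diag l hl
      · rw [elim, elimStep_self_row]
        exact h4
    -- Row `k` is unchanged by its own step and belongs to the block, since `k ≤ m`; hence it
    -- annihilates `x`, and its multiples can be added back to the other rows.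
    · have hk0 := hx k (by omega)
      simp only [elim, sum_elimStep, if_true, zero_mul, sub_zero] at hk0
      refine h.kernel m hm (by omega) x fun i hi => ?_
      have := hx i hi
      simpa only [elim, sum_elimStep, hk0, mul_zero, sub_zero] using this

/-- All pivots of the elimination are nonzero. -/
theorem LeadingRegular.pivot_ne_zero (hM : LeadingRegular n M) {k : ℕ} (hk : k < n) :
    elim M k k k ≠ 0 :=
  (hM.reduced hk.le).pivot_ne_zero hM hk

theorem LeadingRegular.diag_ne_zero (hM : LeadingRegular n M) {k : ℕ} (hk : k < n) :
    elim M n k k ≠ 0 :=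
  (hM.reduced le_rfl).diag k hk

/-- The elimination solves the linear system whose augmented matrix is `M`. -/
theorem LeadingRegular.solution (hM : LeadingRegular n M) {x : ℕ → ℝ}
    (hx : ∀ i < n, ∑ l ∈ Finset.range n, M i l * x l = M i n) {i : ℕ} (hi : i < n) :
    elim M n i n / elim M n i i = x i := by
  have h : ∀ k ≤ n, ∀ i < n, ∑ l ∈ Finset.range n, elim M k i l * x l = elim M k i n := by
    intro k hk
    induction k with
    | zero => exact hx
    | succ k ih =>
      intro i hi
      rw [elim, sum_elimStep, ih (by omega) i hi, ih (by omega) k hk, elimStep]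
  have h1 := h n le_rfl i hi
  rw [Finset.sum_eq_single_of_mem i (Finset.mem_range.2 hi) fun l hl hli => by
    rw [(hM.reduced le_rfl).off_diag i l (Finset.mem_range.1 hl) hli.symm, zero_mul]] at h1
  rw [← h1, mul_div_cancel_left₀ _ (hM.diag_ne_zero hi)]

end

/-! ### Sets of vertices as binary numbers -/

/-- The set of the positions of the ones in the binary expansion of `P`. -/
def bitFinset (n P : ℕ) : Finset (Fin n) := Finset.univ.filter fun i => P.testBit i

theorem mem_bitFinset {n P : ℕ} {i : Fin n} : i ∈ bitFinset n P ↔ P.testBit i = true := by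
  simp [bitFinset]

/-- Bit `j` is zero, so the addition causes no carry: the last `j + 1` bits stay below `2 ^ (j + 1)`
and the higher ones are untouched. -/
theorem Nat.testBit_add_two_pow {P j : ℕ} (h : P.testBit j = false) (i : ℕ) :
    (P + 2 ^ j).testBit i = (decide (i = j) || P.testBit i) := by
  have hlt : P % 2 ^ (j + 1) < 2 ^ j := by
    by_contra hle
    have h1 : (P % 2 ^ (j + 1)).testBit j = true :=
      Nat.testBit_of_two_pow_le_and_two_pow_add_one_gt (not_lt.1 hle)
        (Nat.mod_lt _ (by positivity))
    rw [Nat.testBit_mod_two_pow, h] at h1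
    simp at h1
  have h0 := Nat.div_add_mod P (2 ^ (j + 1))
  have h2 : P % 2 ^ (j + 1) + 2 ^ j < 2 ^ (j + 1) := by rw [pow_succ] at *; omega
  have e1 : P + 2 ^ j = 2 ^ (j + 1) * (P / 2 ^ (j + 1)) + (P % 2 ^ (j + 1) + 2 ^ j) := by omega
  rw [e1, Nat.testBit_two_pow_mul_add _ h2]
  conv_rhs => rw [← h0, Nat.testBit_two_pow_mul_add _ (Nat.mod_lt _ (by positivity))]
  by_cases hi : i < j + 1
  · have e2 := Nat.two_pow_add_eq_or_of_lt hlt 1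
    rw [mul_one] at e2
    rw [if_pos hi, if_pos hi, add_comm, e2, Nat.testBit_or, Nat.testBit_two_pow]
    simp only [eq_comm]
  · have : i ≠ j := by omega
    simp [hi, this]

theorem bitFinset_add_two_pow {n P : ℕ} {j : Fin n} (h : j ∉ bitFinset n P) :
    bitFinset n (P + 2 ^ (j : ℕ)) = insert j (bitFinset n P) := by
  rw [mem_bitFinset, Bool.not_eq_true] at h
  ext i
  rw [Finset.mem_insert, mem_bitFinset, mem_bitFinset, Nat.testBit_add_two_pow h]
  simp [Fin.ext_iff]

theorem bitFinset_two_pow_sub_one (n : ℕ) : bitFinset n (2 ^ n - 1) = Finset.univ := by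
  ext i
  simp [mem_bitFinset]

theorem bitFinset_zero (n : ℕ) : bitFinset n 0 = ∅ := by
  ext i
  simp [mem_bitFinset]

theorem bitFinset_ne_univ {n P : ℕ} (h : P < 2 ^ n - 1) : bitFinset n P ≠ Finset.univ := by
  intro hP
  have : P = 2 ^ n - 1 := by
    refine Nat.eq_of_testBit_eq fun i => ?_
    rw [Nat.testBit_two_pow_sub_one]
    by_cases hi : i < n
    · rw [decide_eq_true hi]
      exact (mem_bitFinset (i := ⟨i, hi⟩)).1 (hP ▸ Finset.mem_univ _)
    · rw [decide_eq_false hi]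
      exact Nat.testBit_lt_two_pow
        ((show P < 2 ^ n by omega).trans_le (Nat.pow_le_pow_right (by norm_num) (by omega)))
  omega

/-! ### The linear systems of the algorithm -/

/-- The augmented matrix of the linear system for the values at the set with binary number `P`:
row `i` is Kirchhoff's law for a unit of time if `i` is in the set, and fixes the value to `T i`
otherwise. -/
def systemMatrix (n : ℕ) (W : ℕ → ℕ → ℝ) (P : ℕ) (T : ℕ → ℝ) (i l : ℕ) : ℝ :=
  let s : ℝ := if P.testBit i then 1 else 0
  let u : ℝ := if P.testBit i then 0 else 1
  let d : ℝ := ∑ m ∈ Finset.range n, s * W i m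
  if l = n then d + u * T i else if l = i then d + u else 0 - s * W i l

section

variable {n : ℕ} (G : WeightedGraph (Fin n))

/-- The weights as a function of natural numbers. -/
def natWeight (k l : ℕ) : ℝ :=
  if h : k < n ∧ l < n then G.weight ⟨k, h.1⟩ ⟨l, h.2⟩ else 0

theorem natWeight_fin (k l : Fin n) : natWeight G k l = G.weight k l := by
  simp [natWeight]

theorem sum_systemMatrix (P : ℕ) (T x : ℕ → ℝ) (i : Fin n) :
    ∑ l ∈ Finset.range n, systemMatrix n (natWeight G) P T i l * x l =
      if i ∈ bitFinset n P then G.laplacian (fun k => x k) i else x i := by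
  rw [Finset.sum_range]
  have h1 : ∀ l : Fin n, (l : ℕ) ≠ n := fun l => l.2.ne
  by_cases h : i ∈ bitFinset n P
  · have h' := mem_bitFinset.1 h
    have h2 : ∀ l : Fin n, systemMatrix n (natWeight G) P T i l * x l =
        (if l = i then (∑ m, G.weight i m) * x i else 0) - G.weight i l * x l := by
      intro l
      simp only [systemMatrix, h', if_true, if_neg (h1 l), Finset.sum_range, natWeight_fin,
        one_mul, Fin.val_inj]
      split_ifs with hl
      -- There are no loops, so the diagonal entry is the full degree.
      · rw [hl, G.weight_self]; ring
      · ring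
    rw [if_pos h, G.laplacian_eq, Finset.sum_congr rfl fun l _ => h2 l, Finset.sum_sub_distrib]
    simp
  · have h' : P.testBit i = false := by rwa [mem_bitFinset, Bool.not_eq_true] at h
    have h2 : ∀ l : Fin n, systemMatrix n (natWeight G) P T i l * x l =
        if l = i then x i else 0 := by
      intro l
      simp only [systemMatrix, h', if_neg (h1 l), Bool.false_eq_true, if_false, zero_mul,
        Finset.sum_const_zero, zero_add, sub_zero, Fin.val_inj]
      split_ifs with hl
      · rw [hl, one_mul]
      · rw [zero_mul]
    rw [if_neg h, Finset.sum_congr rfl fun l _ => h2 l]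
    simp

theorem systemMatrix_rhs (P : ℕ) (T : ℕ → ℝ) (i : Fin n) :
    systemMatrix n (natWeight G) P T i n =
      if i ∈ bitFinset n P then ∑ m, G.weight i m else T i := by
  by_cases h : i ∈ bitFinset n P
  · have h' := mem_bitFinset.1 h
    simp [systemMatrix, h', h, Finset.sum_range, natWeight_fin]
  · have h' : P.testBit i = false := by rwa [mem_bitFinset, Bool.not_eq_true] at h
    simp [systemMatrix, h', h]

variable {G} (hG : G.graph.Connected) {P : ℕ} (hP : P < 2 ^ n - 1)
include hG hP

/-- A vector in the kernel of the leading block, extended by zero, is harmonic on the vertices of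
the set with index at most `k` and zero at all others; uniqueness for this smaller set makes it
vanish. -/
theorem leadingRegular_systemMatrix (T : ℕ → ℝ) :
    LeadingRegular n (systemMatrix n (natWeight G) P T) := by
  intro k hk x hx hrow
  have hQ : (bitFinset n P).filter (fun i : Fin n => (i : ℕ) ≤ k) ≠ Finset.univ := by
    intro h
    refine bitFinset_ne_univ hP (Finset.eq_univ_iff_forall.2 fun i => ?_)
    exact (Finset.mem_filter.1 (h ▸ Finset.mem_univ i)).1
  have h0 := WeightedGraph.eq_zero_of_laplacian_eq_zero hG hQ (φ := fun i => x i) (fun i hi => ?_)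
    (fun i hi => ?_)
  · exact congrFun h0 ⟨k, hk⟩
  · obtain ⟨hi1, hi2⟩ := Finset.mem_filter.1 hi
    have := hrow i hi2
    rwa [sum_systemMatrix, if_pos hi1] at this
  · by_cases hik : (i : ℕ) ≤ k
    · have := hrow i hik
      rwa [sum_systemMatrix, if_neg fun h => hi (Finset.mem_filter.2 ⟨h, hik⟩)] at this
    · exact hx i (not_le.1 hik)

omit hP in
/-- The value `h_{(P ∪ {k}, k), f}` for the set with binary number `P`. -/
def coverValue (G : WeightedGraph (Fin n)) (P k : ℕ) : ℝ :=
  if h : k < n then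
    (G.hitCovered (insert ⟨k, h⟩ (bitFinset n P)) ⟨k, h⟩).toReal else 0

/-- The true values satisfy the system: rows inside the set are first step equations, and rows
outside refer to the enlarged set, since adding `2 ^ i` inserts `i`. -/
theorem coverValue_solution {T : ℕ → ℝ}
    (hT : ∀ i < n, P.testBit i = false → T i = coverValue G (P + 2 ^ i) i) {i : ℕ} (hi : i < n) :
    elim (systemMatrix n (natWeight G) P T) n i n / elim (systemMatrix n (natWeight G) P T) n i i =
      coverValue G P i := by
  refine (leadingRegular_systemMatrix hG hP T).solution (fun i hi => ?_) hi
  rw [sum_systemMatrix G P T _ ⟨i, hi⟩, systemMatrix_rhs G P T ⟨i, hi⟩]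
  have hc : ∀ k : Fin n, coverValue G P k = (G.hitCovered (insert k (bitFinset n P)) k).toReal :=
    fun k => by simp [coverValue]
  by_cases h : (⟨i, hi⟩ : Fin n) ∈ bitFinset n P
  · rw [if_pos h, if_pos h]
    simp only [hc]
    rw [WeightedGraph.laplacian_toReal hG (bitFinset_ne_univ hP) (c := 1)
      (fun l => WeightedGraph.hitCovered_ne_top hG (Finset.mem_insert_self l _))
      ENNReal.one_ne_top h]
    · simp
    · rw [Finset.insert_eq_of_mem h]
      exact WeightedGraph.hitCovered_eq G (bitFinset_ne_univ hP) _
  · have h' : P.testBit i = false := by rwa [mem_bitFinset, Bool.not_eq_true] at h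
    rw [if_neg h, if_neg h, hT i hi h', coverValue, coverValue, dif_pos hi, dif_pos hi,
      bitFinset_add_two_pow h]
    simp

omit hP in omit hG in
theorem coverValue_full (k : ℕ) : coverValue G (2 ^ n - 1) k = 0 := by
  unfold coverValue
  split_ifs with h
  · rw [bitFinset_two_pow_sub_one, Finset.insert_eq_of_mem (Finset.mem_univ _),
      WeightedGraph.hitCovered_univ, ENNReal.toReal_zero]
  · rfl

omit hP in omit hG in
theorem coverValue_zero (i : Fin n) : coverValue G 0 i = (G.coverTime i).toReal := by
  rw [WeightedGraph.coverTime_eq_hitCovered]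
  simp [coverValue, bitFinset_zero]

end

/-! ### Reasoning about programs -/

namespace RAMState

variable (σ : RAMState) (d m k v : ℕ) (x : ℝ)

@[simp] theorem setNat_natReg : (σ.setNat d v).natReg = Function.update σ.natReg d v := rfl
@[simp] theorem setNat_realReg : (σ.setNat d v).realReg = σ.realReg := rfl
@[simp] theorem setNat_natArr : (σ.setNat d v).natArr = σ.natArr := rfl
@[simp] theorem setNat_realArr : (σ.setNat d v).realArr = σ.realArr := rfl
@[simp] theorem setReal_natReg : (σ.setReal d x).natReg = σ.natReg := rfl
@[simp] theorem setReal_realReg : (σ.setReal d x).realReg = Function.update σ.realReg d x := rfl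
@[simp] theorem setReal_natArr : (σ.setReal d x).natArr = σ.natArr := rfl
@[simp] theorem setReal_realArr : (σ.setReal d x).realArr = σ.realArr := rfl
@[simp] theorem setNatArr_natReg : (σ.setNatArr m k v).natReg = σ.natReg := rfl
@[simp] theorem setNatArr_realReg : (σ.setNatArr m k v).realReg = σ.realReg := rfl
@[simp] theorem setNatArr_natArr : (σ.setNatArr m k v).natArr =
    Function.update σ.natArr m (Function.update (σ.natArr m) k v) := rfl
@[simp] theorem setNatArr_realArr : (σ.setNatArr m k v).realArr = σ.realArr := rfl
@[simp] theorem setRealArr_natReg : (σ.setRealArr m k x).natReg = σ.natReg := rfl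
@[simp] theorem setRealArr_realReg : (σ.setRealArr m k x).realReg = σ.realReg := rfl
@[simp] theorem setRealArr_natArr : (σ.setRealArr m k x).natArr = σ.natArr := rfl
@[simp] theorem setRealArr_realArr : (σ.setRealArr m k x).realArr =
    Function.update σ.realArr m (Function.update (σ.realArr m) k x) := rfl

end RAMState

namespace RAMProg

infixr:60 " ⨟ " => RAMProg.seq

/-- Started in `σ`, the program `p` halts after at most `T` steps, in a state with property `Q`. -/
def Runs (p : RAMProg) (σ : RAMState) (T : ℕ) (Q : RAMState → Prop) : Prop :=
  ∃ t τ, Exec p σ t τ ∧ t ≤ T ∧ Q τ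

namespace Runs

variable {p q : RAMProg} {σ τ : RAMState} {s t T : ℕ} {Q R : RAMState → Prop}

theorem mono (h : Runs p σ t Q) (ht : t ≤ T) (hQ : ∀ τ, Q τ → R τ) : Runs p σ T R := by
  obtain ⟨t', τ, h1, h2, h3⟩ := h
  exact ⟨t', τ, h1, h2.trans ht, hQ τ h3⟩

theorem le (h : Runs p σ t Q) (ht : t ≤ T) : Runs p σ T Q := h.mono ht fun _ => id

theorem last (h : Exec p σ t τ) (hQ : Q τ) : Runs p σ t Q := ⟨t, τ, h, le_rfl, hQ⟩

theorem step (h : Exec p σ 1 τ) (hq : Runs q τ t Q) : Runs (p ⨟ q) σ (t + 1) Q := by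
  obtain ⟨t', ρ, h1, h2, h3⟩ := hq
  exact ⟨1 + t', ρ, .seq h h1, by omega, h3⟩

section instructions

variable {d m a b k v c : ℕ} {x : ℝ}

theorem natConst (h : Runs q (σ.setNat d c) t Q) : Runs (.natConst d c ⨟ q) σ (t + 1) Q :=
  step (.natConst ..) h

/-- The result `v` is a free parameter with an equation, so that a proof about a program can name
the value in closed form at each instruction. -/
theorem natAdd (hv : σ.natReg a + σ.natReg b = v) (h : Runs q (σ.setNat d v) t Q) :
    Runs (.natAdd d a b ⨟ q) σ (t + 1) Q :=
  step (.natAdd ..) (hv.symm ▸ h)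

theorem natSub (hv : σ.natReg a - σ.natReg b = v) (h : Runs q (σ.setNat d v) t Q) :
    Runs (.natSub d a b ⨟ q) σ (t + 1) Q :=
  step (.natSub ..) (hv.symm ▸ h)

theorem natLoad (hv : σ.natArr m (σ.natReg a) = v) (h : Runs q (σ.setNat d v) t Q) :
    Runs (.natLoad d m a ⨟ q) σ (t + 1) Q :=
  step (.natLoad ..) (hv.symm ▸ h)

theorem natStore (hk : σ.natReg a = k) (hv : σ.natReg b = v) (h : Runs q (σ.setNatArr m k v) t Q) :
    Runs (.natStore m a b ⨟ q) σ (t + 1) Q := by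
  subst hk hv
  exact step (.natStore ..) h

theorem realConst {c : ℤ} (hx : (c : ℝ) = x) (h : Runs q (σ.setReal d x) t Q) :
    Runs (.realConst d c ⨟ q) σ (t + 1) Q :=
  step (.realConst ..) (hx.symm ▸ h)

theorem realAdd (hx : σ.realReg a + σ.realReg b = x) (h : Runs q (σ.setReal d x) t Q) :
    Runs (.realAdd d a b ⨟ q) σ (t + 1) Q :=
  step (.realAdd ..) (hx.symm ▸ h)

theorem realSub (hx : σ.realReg a - σ.realReg b = x) (h : Runs q (σ.setReal d x) t Q) :
    Runs (.realSub d a b ⨟ q) σ (t + 1) Q :=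
  step (.realSub ..) (hx.symm ▸ h)

theorem realMul (hx : σ.realReg a * σ.realReg b = x) (h : Runs q (σ.setReal d x) t Q) :
    Runs (.realMul d a b ⨟ q) σ (t + 1) Q :=
  step (.realMul ..) (hx.symm ▸ h)

theorem realDiv (hb : σ.realReg b ≠ 0) (hx : σ.realReg a / σ.realReg b = x)
    (h : Runs q (σ.setReal d x) t Q) : Runs (.realDiv d a b ⨟ q) σ (t + 1) Q :=
  step (.realDiv _ _ _ _ hb) (hx.symm ▸ h)

theorem realLoad (hk : σ.natReg a = k) (hx : σ.realArr m k = x) (h : Runs q (σ.setReal d x) t Q) :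
    Runs (.realLoad d m a ⨟ q) σ (t + 1) Q := by
  subst hk hx
  exact step (.realLoad ..) h

theorem realStore (hk : σ.natReg a = k) (hx : σ.realReg b = x)
    (h : Runs q (σ.setRealArr m k x) t Q) : Runs (.realStore m a b ⨟ q) σ (t + 1) Q := by
  subst hk hx
  exact step (.realStore ..) h

/-- The last instruction of the body of a loop increments the counter. -/
theorem incr (hv : σ.natReg a + σ.natReg b = v) (h : Q (σ.setNat d v)) :
    Runs (.natAdd d a b) σ 1 Q :=
  last (.natAdd ..) (hv.symm ▸ h)

end instructions

theorem seq (hp : Runs p σ s R) (hq : ∀ τ, R τ → Runs q τ t Q) : Runs (p ⨟ q) σ (s + t) Q := by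
  obtain ⟨t1, τ, h1, h2, h3⟩ := hp
  obtain ⟨t2, ρ, h4, h5, h6⟩ := hq τ h3
  exact ⟨t1 + t2, ρ, .seq h1 h4, by omega, h6⟩

theorem ite {c : RAMTest} (h1 : c.Holds σ → Runs p σ t Q) (h2 : ¬ c.Holds σ → Runs q σ t Q) :
    Runs (.ite c p q) σ (t + 1) Q := by
  by_cases hc : c.Holds σ
  · obtain ⟨t', τ, h, h', h''⟩ := h1 hc
    exact ⟨t' + 1, τ, .ite_true hc h, by omega, h''⟩
  · obtain ⟨t', τ, h, h', h''⟩ := h2 hc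
    exact ⟨t' + 1, τ, .ite_false hc h, by omega, h''⟩

/-- A loop with invariant `I` whose test succeeds exactly `m` times. -/
theorem loop {c : RAMTest} {m : ℕ} (I : ℕ → RAMState → Prop) (h0 : I 0 σ)
    (hc : ∀ j τ, j ≤ m → I j τ → (c.Holds τ ↔ j < m))
    (hbody : ∀ j τ, j < m → I j τ → Runs p τ t (I (j + 1))) :
    Runs (.while c p) σ (m * (t + 1) + 1) (I m) := by
  -- Induction on the number `d` of remaining passes; each pass pays one unit for its test, and the
  -- final failing test pays the last one.
  suffices h : ∀ d j τ, j + d = m → I j τ → Runs (.while c p) τ (d * (t + 1) + 1) (I m) from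
    h m 0 σ (zero_add m) h0
  intro d
  induction d with
  | zero =>
    rintro j τ rfl hI
    exact ⟨1, τ, .while_false fun h => (lt_irrefl _ ((hc _ _ le_rfl hI).1 h)), by omega, hI⟩
  | succ d ih =>
    intro j τ hj hI
    obtain ⟨t1, τ1, h1, h2, h3⟩ := hbody j τ (by omega) hI
    obtain ⟨t2, τ2, h4, h5, h6⟩ := ih (j + 1) τ1 (by omega) h3
    refine ⟨t1 + t2 + 1, τ2, .while_true ((hc j τ (by omega) hI).2 (by omega)) h1 h4, ?_, h6⟩
    rw [add_mul]
    omega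

end Runs

end RAMProg

/-- Only natural registers from `b` on, real registers and the real array `2` have changed. -/
structure RAMState.Frame (b : ℕ) (σ τ : RAMState) : Prop where
  natReg : ∀ r < b, τ.natReg r = σ.natReg r
  natArr : τ.natArr = σ.natArr
  realArr : ∀ m, m ≠ 2 → τ.realArr m = σ.realArr m

namespace RAMState.Frame

variable {b : ℕ} {σ τ ρ : RAMState}

theorem refl (b : ℕ) (σ : RAMState) : Frame b σ σ := ⟨fun _ _ => rfl, rfl, fun _ _ => rfl⟩

theorem trans {c : ℕ} (h1 : Frame b σ τ) (h2 : Frame c τ ρ) (h : b ≤ c) : Frame b σ ρ :=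
  ⟨fun r hr => (h2.natReg r (hr.trans_le h)).trans (h1.natReg r hr), h2.natArr.trans h1.natArr,
    fun m hm => (h2.realArr m hm).trans (h1.realArr m hm)⟩

theorem setNat (h : Frame b σ τ) {d v : ℕ} (hd : b ≤ d) : Frame b σ (τ.setNat d v) :=
  ⟨fun r hr => (Function.update_of_ne (by omega) _ _).trans (h.natReg r hr), h.natArr, h.realArr⟩

theorem setReal (h : Frame b σ τ) {d : ℕ} {x : ℝ} : Frame b σ (τ.setReal d x) :=
  ⟨h.natReg, h.natArr, h.realArr⟩

theorem setRealArr (h : Frame b σ τ) {k : ℕ} {x : ℝ} : Frame b σ (τ.setRealArr 2 k x) :=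
  ⟨h.natReg, h.natArr, fun m hm => (Function.update_of_ne hm _ _).trans (h.realArr m hm)⟩

end RAMState.Frame

/-- The matrix stored column by column in the real array `2`. -/
def RAMState.mat (n : ℕ) (σ : RAMState) (i l : ℕ) : ℝ := σ.realArr 2 (l * n + i)

namespace RAMState

variable {n : ℕ} (σ : RAMState)

@[simp] theorem mat_setNat (d v : ℕ) : (σ.setNat d v).mat n = σ.mat n := rfl
@[simp] theorem mat_setReal (d : ℕ) (x : ℝ) : (σ.setReal d x).mat n = σ.mat n := rfl

/-- Uniqueness of division with remainder; it serves the matrix and the weights with width `n` and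
the table of solutions with width `2 ^ n`. -/
theorem address_inj {i i' l l' : ℕ} (hi : i < n) (hi' : i' < n) :
    l' * n + i' = l * n + i ↔ i' = i ∧ l' = l := by
  constructor
  · intro h
    have h1 : i' = i := by
      have := congrArg (· % n) h
      simpa [Nat.mod_eq_of_lt hi, Nat.mod_eq_of_lt hi'] using this
    subst h1
    exact ⟨rfl, Nat.eq_of_mul_eq_mul_right (by omega) (Nat.add_right_cancel h)⟩
  · rintro ⟨rfl, rfl⟩; rfl

theorem mat_setRealArr {i i' l a : ℕ} (hi : i < n) (hi' : i' < n) (l' : ℕ) (x : ℝ)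
    (ha : a = l * n + i) :
    (σ.setRealArr 2 a x).mat n i' l' = if i' = i ∧ l' = l then x else σ.mat n i' l' := by
  subst ha
  simp only [mat, setRealArr_realArr, Function.update_self, Function.update_apply,
    address_inj hi hi']

end RAMState

/-! ### The program -/

namespace CoverProg

open RAMProg RAMTest

/-- Subtract the multiple, by the factor in the real register `3`, of row `k` (register `7`) from
row `i` (register `8`). -/
def elimRow : RAMProg :=
  .natConst 10 0 ⨟
  .while (.natLt 10 4) (
    .natLoad 11 2 10 ⨟ .natAdd 12 11 7 ⨟ .natAdd 13 11 8 ⨟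
    .realLoad 4 2 12 ⨟ .realMul 4 3 4 ⨟ .realLoad 5 2 13 ⨟ .realSub 4 5 4 ⨟ .realStore 2 13 4 ⨟
    .natAdd 10 10 2)

/-- The constants `1`, `n` and `n + 1` and the table of multiples of `n` are in place. -/
structure Consts (n : ℕ) (σ : RAMState) : Prop where
  size : σ.natReg 0 = n
  one : σ.natReg 2 = 1
  width : σ.natReg 4 = n + 1
  mul : ∀ l ≤ n, σ.natArr 2 l = l * n

theorem Consts.of_frame {n b : ℕ} {σ τ : RAMState} (h : Consts n σ) (hf : σ.Frame b τ)
    (hb : 5 ≤ b) : Consts n τ :=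
  ⟨(hf.natReg 0 (by omega)).trans h.size, (hf.natReg 2 (by omega)).trans h.one,
    (hf.natReg 4 (by omega)).trans h.width, fun l hl => by rw [hf.natArr]; exact h.mul l hl⟩

theorem runs_elimRow {n i k : ℕ} {f : ℝ} {σ : RAMState} (hσ : Consts n σ) (hi : i < n) (hk : k < n)
    (h7 : σ.natReg 7 = k) (h8 : σ.natReg 8 = i) (hf : σ.realReg 3 = f) (hik : k = i → f = 0) :
    elimRow.Runs σ (10 * n + 12) fun τ => σ.Frame 10 τ ∧ ∀ i' < n, ∀ l ≤ n,
      τ.mat n i' l = if i' = i then σ.mat n i l - f * σ.mat n k l else σ.mat n i' l := by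
  -- Nine instructions and a test for each of the `n + 1` columns, right-hand side included, then a
  -- failing test and the initial assignment: `10 (n + 1) + 2`.
  refine Runs.le (.natConst (Runs.mono (Runs.loop (m := n + 1) (t := 9) (fun j τ =>
    σ.Frame 10 τ ∧ τ.natReg 10 = j ∧ τ.realReg 3 = f ∧ ∀ i' < n, ∀ l ≤ n,
      τ.mat n i' l = if i' = i ∧ l < j then σ.mat n i l - f * σ.mat n k l else σ.mat n i' l)
    ?_ ?_ ?_) le_rfl ?_)) ?_
  · exact ⟨.setNat (.refl _ _) le_rfl, by simp, by simpa using hf, by simp⟩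
  · rintro j τ hj ⟨hF, h10, -⟩
    simp [RAMTest.Holds, h10, hF.natReg 4, hσ.width]
  · rintro j τ hj ⟨hF, h10, h3, hM⟩
    have hc := hσ.of_frame hF (by norm_num)
    have e7 := (hF.natReg 7 (by norm_num)).trans h7
    have e8 := (hF.natReg 8 (by norm_num)).trans h8
    have em := hc.mul j (by omega)
    have a1 : τ.realArr 2 (j * n + i) = σ.mat n i j := by
      exact (hM i hi j (by omega)).trans (by simp)
    have a2 : f * τ.realArr 2 (j * n + k) = f * σ.mat n k j := by
      by_cases h : k = i
      · rw [hik h, zero_mul, zero_mul]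
      · congr 1
        exact (hM k hk j (by omega)).trans (by simp [h])
    refine .natLoad (v := j * n) (by simp [h10, em]) <|
      .natAdd (v := j * n + k) (by simp [e7]) <|
      .natAdd (v := j * n + i) (by simp [e8]) <|
      .realLoad (k := j * n + k) (by simp) rfl <|
      .realMul (x := f * σ.mat n k j) (by simpa [h3] using a2) <|
      .realLoad (k := j * n + i) (x := σ.mat n i j) (by simp) (by simpa using a1) <|
      .realSub (x := σ.mat n i j - f * σ.mat n k j) (by simp) <|
      .realStore (k := j * n + i) (x := σ.mat n i j - f * σ.mat n k j) (by simp) (by simp) <|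
      .incr (v := j + 1) (by simp [h10, hc.one]) ⟨?_, by simp, by simp [h3], fun i' hi' l hl => ?_⟩
    · repeat first
        | exact hF
        | refine .setNat ?_ (by norm_num)
        | refine .setReal ?_
        | refine .setRealArr ?_
    · rw [RAMState.mat_setNat, RAMState.mat_setRealArr _ hi hi' _ _ rfl]
      simp only [RAMState.mat_setNat, RAMState.mat_setReal, hM i' hi' l hl]
      grind
  · rintro τ ⟨hF, -, -, hM⟩
    refine ⟨hF, fun i' hi' l hl => ?_⟩
    simp [hM i' hi' l hl, Nat.lt_succ_of_le hl]
  · omega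

/-- Set the factor in the real register `3` to zero if the natural registers `7` and `8` agree. -/
def clearOnPivot : RAMProg :=
  .ite (.natLt 8 7) .skip (.ite (.natLt 7 8) .skip (.realConst 3 0))

/-- Equality is not a primitive test; it is the failure of both strict comparisons. -/
theorem runs_clearOnPivot {n i k : ℕ} {f : ℝ} {σ : RAMState} (h7 : σ.natReg 7 = k)
    (h8 : σ.natReg 8 = i) (hf : σ.realReg 3 = f) :
    clearOnPivot.Runs σ 3 fun τ => σ.Frame 10 τ ∧ τ.mat n = σ.mat n ∧
      τ.realReg 3 = if i = k then 0 else f := by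
  refine Runs.ite (t := 2) (fun h => (Runs.last (.skip _) ⟨.refl _ _, rfl, ?_⟩).le (by norm_num))
    fun h => Runs.ite (t := 1) (fun h' => Runs.last (.skip _) ⟨.refl _ _, rfl, ?_⟩)
      fun h' => Runs.last (.realConst ..) ⟨.setReal (.refl _ _), rfl, ?_⟩
  all_goals simp only [RAMTest.Holds] at *
  all_goals first
    | rw [if_neg (by omega), hf]
    | rw [if_pos (by omega)]; simp

/-- Gauss–Jordan elimination, without pivoting, of the matrix in the real array `2`. -/
def elimination : RAMProg :=
  .natConst 7 0 ⨟
  .while (.natLt 7 0) (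
    .natConst 8 0 ⨟
    .while (.natLt 8 0) (
      .natLoad 10 2 7 ⨟ .natAdd 11 10 7 ⨟ .natAdd 12 10 8 ⨟
      .realLoad 2 2 11 ⨟ .realLoad 3 2 12 ⨟ .realDiv 3 3 2 ⨟
      clearOnPivot ⨟ elimRow ⨟
      .natAdd 8 8 2) ⨟
    .natAdd 7 7 2)

theorem runs_elimination {n : ℕ} {σ : RAMState} (hσ : Consts n σ)
    (hpiv : ∀ k < n, elim (σ.mat n) k k k ≠ 0) :
    elimination.Runs σ (50 * (n + 1) ^ 3) fun τ => σ.Frame 7 τ ∧ ∀ i < n, ∀ l ≤ n,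
      τ.mat n i l = elim (σ.mat n) n i l := by
  refine Runs.le (.natConst (Runs.mono (Runs.loop (m := n) (t := n * (10 * n + 24) + 3) (fun k τ =>
    σ.Frame 7 τ ∧ τ.natReg 7 = k ∧ ∀ i < n, ∀ l ≤ n, τ.mat n i l = elim (σ.mat n) k i l)
    ?_ ?_ ?_) le_rfl ?_)) ?_
  · exact ⟨.setNat (.refl _ _) le_rfl, by simp, by simp [elim]⟩
  · rintro k τ hk ⟨hF, h7, -⟩
    simp [RAMTest.Holds, h7, hF.natReg 0, hσ.size]
  · rintro k τ hk ⟨hF, h7, hM⟩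
    refine Runs.le (.natConst (Runs.seq (t := 1) (Runs.loop (m := n) (t := 10 * n + 23) (fun j ρ =>
      τ.Frame 8 ρ ∧ ρ.natReg 8 = j ∧ ∀ i < n, ∀ l ≤ n, ρ.mat n i l =
        if i < j then elim (σ.mat n) (k + 1) i l else elim (σ.mat n) k i l) ?_ ?_ ?_) ?_)) ?_
    · exact ⟨.setNat (.refl _ _) le_rfl, by simp, by simpa using hM⟩
    · rintro j ρ hj ⟨hF', h8, -⟩
      simp [RAMTest.Holds, h8, hF'.natReg 0, hF.natReg 0, hσ.size]
    · rintro j ρ hj ⟨hF', h8, hM'⟩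
      have hc := (hσ.of_frame hF (by norm_num)).of_frame hF' (by norm_num)
      have e7 := (hF'.natReg 7 (by norm_num)).trans h7
      have em := hc.mul k (by omega)
      -- The pivot row is the same before and after step `k`, so it can be read whether or not the
      -- inner loop has already passed it.
      have hrow : ∀ l ≤ n, ρ.mat n k l = elim (σ.mat n) k k l := fun l hl => by
        rw [hM' k hk l hl, elim, elimStep_self_row, ite_self]
      have a1 : ρ.realArr 2 (k * n + k) = elim (σ.mat n) k k k := hrow k hk.le
      have a2 : ρ.realArr 2 (k * n + j) = elim (σ.mat n) k j k := by
        exact (hM' j hj k hk.le).trans (by simp)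
      refine Runs.le (.natLoad (v := k * n) (by simp [e7, em]) <|
        .natAdd (v := k * n + k) (by simp [e7]) <|
        .natAdd (v := k * n + j) (by simp [h8]) <|
        .realLoad (k := k * n + k) (x := elim (σ.mat n) k k k) (by simp) (by simpa using a1) <|
        .realLoad (k := k * n + j) (x := elim (σ.mat n) k j k) (by simp) (by simpa using a2) <|
        .realDiv (x := elim (σ.mat n) k j k / elim (σ.mat n) k k k) (by simpa using hpiv k hk)
          (by simp) <|
        Runs.seq (s := 3) (t := 10 * n + 12 + 1) (R := fun π => ρ.Frame 10 π ∧ π.mat n = ρ.mat n ∧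
          π.realReg 3 = if j = k then 0 else elim (σ.mat n) k j k / elim (σ.mat n) k k k) ?_ ?_) ?_
      · refine (runs_clearOnPivot (n := n) (i := j) (k := k) (by simpa using e7) (by simpa using h8)
          (by simp)).mono le_rfl fun π hπ => ⟨.trans ?_ hπ.1 le_rfl, hπ.2.1, hπ.2.2⟩
        exact .setReal (.setReal (.setReal (.setNat (.setNat (.setNat (.refl _ _) le_rfl)
          (by norm_num)) (by norm_num))))
      · rintro π ⟨hF2, hMp, hp3⟩
        refine Runs.seq (runs_elimRow (hc.of_frame hF2 (by norm_num)) hj hk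
          ((hF2.natReg 7 (by norm_num)).trans e7) ((hF2.natReg 8 (by norm_num)).trans h8) hp3
          (fun h => if_pos h.symm)) ?_
        rintro θ ⟨hF3, hM3⟩
        have hF4 := hF2.trans hF3 le_rfl
        refine .incr (v := j + 1) ?_ ⟨.setNat (hF'.trans hF4 (by norm_num)) le_rfl, by simp,
          fun i hi l hl => ?_⟩
        · rw [hF4.natReg 8 (by norm_num), hF4.natReg 2 (by norm_num), h8, hc.one]
        · rw [RAMState.mat_setNat, hM3 i hi l hl, hMp, hrow l hl, hM' i hi l hl, hM' j hj l hl]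
          simp only [elim, elimStep]
          grind
      · omega
    · rintro ρ ⟨hF', -, hM'⟩
      refine .incr (v := k + 1) ?_ ⟨.setNat (hF.trans hF' (by norm_num)) le_rfl, by simp,
          fun i hi l hl => ?_⟩
      · rw [hF'.natReg 7 (by norm_num), hF'.natReg 2 (by norm_num), h7, hF.natReg 2 (by norm_num),
          hσ.one]
      · rw [RAMState.mat_setNat, hM' i hi l hl, if_pos hi]
    · ring_nf; omega
  · rintro τ ⟨hF, -, hM⟩
    exact ⟨hF, hM⟩
  · nlinarith [Nat.zero_le (n ^ 2), Nat.zero_le (n ^ 3)]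

end CoverProg

/-! ### Assembling the linear systems in memory -/

namespace CoverProg

open RAMProg RAMTest

/-- For `i ≥ n` the address `l * n + i` falls into another column, so memory agrees with the
intended matrix only in this range; elimination reads nothing outside it. -/
theorem elim_congr {n : ℕ} {M M' : ℕ → ℕ → ℝ} (h : ∀ i < n, ∀ l ≤ n, M i l = M' i l) {k : ℕ}
    (hk : k ≤ n) : ∀ i < n, ∀ l ≤ n, elim M k i l = elim M' k i l := by
  induction k with
  | zero => exact h
  | succ k ih =>
    intro i hi l hl
    have ih := ih (by omega)
    simp only [elim, elimStep, ih i hi l hl, ih i hi k (by omega), ih k hk k (by omega),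
      ih k hk l hl]

/-- The table of the solutions, stored in the real array `1`. -/
def _root_.RAMState.tab (n : ℕ) (σ : RAMState) (P i : ℕ) : ℝ := σ.realArr 1 (i * 2 ^ n + P)

/-- The memory during the main loop: besides the constants, the powers of two and the multiples of
`2 ^ n` have been tabulated, and the weights `W` are in the real array `0`. -/
structure Env (n : ℕ) (W : ℕ → ℕ → ℝ) (σ : RAMState) : Prop extends Consts n σ where
  card : σ.natReg 3 = 2 ^ n
  pow : ∀ j < n, σ.natArr 0 j = 2 ^ j
  offset : ∀ j < n, σ.natArr 1 j = j * 2 ^ n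
  weight : ∀ i < n, ∀ l < n, σ.realArr 0 (l * n + i) = W i l

theorem Env.congr {n : ℕ} {W : ℕ → ℕ → ℝ} {σ τ : RAMState} (h : Env n W σ)
    (h1 : ∀ r < 5, τ.natReg r = σ.natReg r) (h2 : τ.natArr = σ.natArr)
    (h3 : τ.realArr 0 = σ.realArr 0) : Env n W τ := by
  refine ⟨⟨?_, ?_, ?_, ?_⟩, ?_, ?_, ?_, ?_⟩
  · rw [h1 0 (by norm_num), h.size]
  · rw [h1 2 (by norm_num), h.one]
  · rw [h1 4 (by norm_num), h.width]
  · rw [h2]; exact h.mul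
  · rw [h1 3 (by norm_num), h.card]
  · rw [h2]; exact h.pow
  · rw [h2]; exact h.offset
  · rw [h3]; exact h.weight

theorem Env.of_frame {n b : ℕ} {W : ℕ → ℕ → ℝ} {σ τ : RAMState} (h : Env n W σ)
    (hf : σ.Frame b τ) (hb : 5 ≤ b) : Env n W τ :=
  h.congr (fun r hr => hf.natReg r (hr.trans_le hb)) hf.natArr (hf.realArr 0 (by norm_num))

/-- Write `-s W i l` into row `i` (register `8`) for all `l < n`, where `s` is in the real register
`3`, and add up the entries `s W i l` in the real register `5`. -/
def fillRow : RAMProg :=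
  .natConst 10 0 ⨟
  .while (.natLt 10 0) (
    .natLoad 11 2 10 ⨟ .natAdd 11 11 8 ⨟ .realLoad 7 0 11 ⨟ .realMul 7 3 7 ⨟
    .realAdd 5 5 7 ⨟ .realSub 7 6 7 ⨟ .realStore 2 11 7 ⨟
    .natAdd 10 10 2)

theorem runs_fillRow {n i : ℕ} {W : ℕ → ℕ → ℝ} {s : ℝ} {σ : RAMState} (hσ : Env n W σ) (hi : i < n)
    (h8 : σ.natReg 8 = i) (h3 : σ.realReg 3 = s) (h5 : σ.realReg 5 = 0) (h6 : σ.realReg 6 = 0) :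
    fillRow.Runs σ (9 * n + 2) fun τ => σ.Frame 10 τ ∧ τ.realReg 2 = σ.realReg 2 ∧
      τ.realReg 4 = σ.realReg 4 ∧ τ.realReg 5 = ∑ m ∈ Finset.range n, s * W i m ∧
      ∀ i' < n, ∀ l ≤ n,
        τ.mat n i' l = if i' = i ∧ l < n then 0 - s * W i l else σ.mat n i' l := by
  refine Runs.le (.natConst (Runs.mono (Runs.loop (m := n) (t := 8) (fun j τ =>
    (σ.Frame 10 τ ∧ τ.realReg 2 = σ.realReg 2 ∧
      τ.realReg 4 = σ.realReg 4 ∧ τ.realReg 5 = ∑ m ∈ Finset.range j, s * W i m ∧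
      ∀ i' < n, ∀ l ≤ n,
        τ.mat n i' l = if i' = i ∧ l < j then 0 - s * W i l else σ.mat n i' l) ∧
      τ.natReg 10 = j ∧ τ.realReg 3 = s ∧ τ.realReg 6 = 0)
    ?_ ?_ ?_) le_rfl fun τ h => h.1)) ?_
  · exact ⟨⟨.setNat (.refl _ _) le_rfl, by simp, by simp, by simpa using h5, by simp⟩, by simp,
      by simpa using h3, by simpa using h6⟩
  · rintro j τ hj ⟨⟨hF, -⟩, h10, -⟩
    simp [RAMTest.Holds, h10, hF.natReg 0, hσ.size]
  · rintro j τ hj ⟨⟨hF, e2, e4, e5, hM⟩, h10, e3, e6⟩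
    have hc := hσ.of_frame hF (by norm_num)
    have e8 := (hF.natReg 8 (by norm_num)).trans h8
    have em := hc.mul j (by omega)
    refine .natLoad (v := j * n) (by simp [h10, em]) <|
      .natAdd (v := j * n + i) (by simp [e8]) <|
      .realLoad (k := j * n + i) (x := W i j) (by simp) (by simpa using hc.weight i hi j hj) <|
      .realMul (x := s * W i j) (by simp [e3]) <|
      .realAdd (x := ∑ m ∈ Finset.range (j + 1), s * W i m)
        (by simp [e5, Finset.sum_range_succ]) <|
      .realSub (x := 0 - s * W i j) (by simp [e6]) <|
      .realStore (k := j * n + i) (x := 0 - s * W i j) (by simp) (by simp) <|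
      .incr (v := j + 1) (by simp [h10, hc.one])
        ⟨⟨?_, by simp [e2], by simp [e4], by simp, fun i' hi' l hl => ?_⟩,
          by simp, by simp [e3], by simp [e6]⟩
    · repeat first
        | exact hF
        | refine .setNat ?_ (by norm_num)
        | refine .setReal ?_
        | refine .setRealArr ?_
    · rw [RAMState.mat_setNat, RAMState.mat_setRealArr _ hi hi' _ _ rfl]
      simp only [RAMState.mat_setNat, RAMState.mat_setReal, hM i' hi' l hl]
      grind
  · omega

/-- Decide whether the bit whose value is in the register `10` is set in the remainder in the
register `9`, and remove it. -/
def splitBit : RAMProg :=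
  .ite (.natLt 9 10) (.realConst 3 0 ⨟ .realConst 4 1)
    (.natSub 9 9 10 ⨟ .realConst 3 1 ⨟ .realConst 4 0)

/-- `P % 2 ^ (i + 1)` is `P % 2 ^ i` plus `2 ^ i` times bit `i`, so one comparison reads the top bit
and one subtraction removes it. -/
theorem runs_splitBit {n P i : ℕ} {σ : RAMState} (h9 : σ.natReg 9 = P % 2 ^ (i + 1))
    (h10 : σ.natReg 10 = 2 ^ i) :
    splitBit.Runs σ 4 fun τ => σ.Frame 9 τ ∧ τ.natReg 9 = P % 2 ^ i ∧
      τ.realReg 2 = σ.realReg 2 ∧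
      τ.realReg 3 = (if P.testBit i then 1 else 0) ∧
      τ.realReg 4 = (if P.testBit i then 0 else 1) ∧ τ.mat n = σ.mat n := by
  have hmod : P % 2 ^ (i + 1) = P % 2 ^ i + 2 ^ i * (P.testBit i).toNat := by
    rw [Nat.mod_pow_succ, Nat.toNat_testBit]
  have hlt := Nat.mod_lt P (show 2 ^ i > 0 by positivity)
  refine Runs.ite (t := 3) (fun h => ?_) fun h => ?_
  all_goals simp only [RAMTest.Holds, h9, h10] at h
  · have hb : P.testBit i = false := by
      by_contra hb
      simp only [Bool.not_eq_false] at hb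
      rw [hb, Bool.toNat_true] at hmod
      omega
    rw [hb, Bool.toNat_false, mul_zero, add_zero] at hmod
    refine Runs.le (.step (.realConst ..) <| .last (.realConst ..) ⟨?_, ?_, ?_, ?_, ?_, ?_⟩)
      (by norm_num)
    · exact .setReal (.setReal (.refl _ _))
    · simp [h9, hmod]
    all_goals simp [hb]
  · have hb : P.testBit i = true := by
      by_contra hb
      simp only [Bool.not_eq_true] at hb
      rw [hb, Bool.toNat_false] at hmod
      omega
    rw [hb, Bool.toNat_true, mul_one] at hmod
    refine .natSub (v := P % 2 ^ i) (by rw [h9, h10]; omega) <| .step (.realConst ..) <|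
      .last (.realConst ..) ⟨?_, ?_, ?_, ?_, ?_, ?_⟩
    · exact .setReal (.setReal (.setNat (.refl _ _) le_rfl))
    all_goals simp [hb]

/-- Assemble the linear system for the set whose binary number is in the register `6`. -/
def assemble : RAMProg :=
  .natConst 10 0 ⨟ .natAdd 9 6 10 ⨟ .natConst 7 0 ⨟
  .while (.natLt 7 0) (
    .natSub 8 0 7 ⨟ .natSub 8 8 2 ⨟ .natLoad 10 0 8 ⨟ .natLoad 11 1 8 ⨟
    .natAdd 12 11 6 ⨟ .natAdd 12 12 10 ⨟ .realLoad 2 1 12 ⨟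
    splitBit ⨟
    .realConst 5 0 ⨟ .realConst 6 0 ⨟
    fillRow ⨟
    .natLoad 10 2 8 ⨟ .natAdd 10 10 8 ⨟ .realAdd 7 5 4 ⨟ .realStore 2 10 7 ⨟
    .natLoad 10 2 0 ⨟ .natAdd 10 10 8 ⨟ .realMul 7 4 2 ⨟ .realAdd 7 5 7 ⨟ .realStore 2 10 7 ⨟
    .natAdd 7 7 2)

theorem runs_assemble {n P : ℕ} {W : ℕ → ℕ → ℝ} {σ : RAMState} (hσ : Env n W σ)
    (hP : P < 2 ^ n) (h6 : σ.natReg 6 = P) :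
    assemble.Runs σ (n * (9 * n + 26) + 4) fun τ => σ.Frame 7 τ ∧ ∀ i < n, ∀ l ≤ n,
      τ.mat n i l = systemMatrix n W P (fun i => σ.tab n (P + 2 ^ i) i) i l := by
  set M := systemMatrix n W P (fun i => σ.tab n (P + 2 ^ i) i) with hMdef
  -- Bits are split off from the top, so rows are built from `n - 1` downwards; after `c` rows the
  -- remainder is `P % 2 ^ (n - c)`.
  refine Runs.le (.natConst <| .natAdd (v := P) (by simp [h6]) <| .natConst <|
    Runs.mono (Runs.loop (m := n) (t := 9 * n + 25) (fun c τ => σ.Frame 7 τ ∧ τ.natReg 7 = c ∧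
      τ.natReg 9 = P % 2 ^ (n - c) ∧ ∀ i < n, n - c ≤ i → ∀ l ≤ n, τ.mat n i l = M i l)
    ?_ ?_ ?_) le_rfl ?_) ?_
  · refine ⟨.setNat (.setNat (.setNat (.refl _ _) (by norm_num)) (by norm_num)) (by norm_num),
      by simp, by simp [Nat.mod_eq_of_lt hP], fun i hi hi' => ?_⟩
    omega
  · rintro c τ hc ⟨hF, h7, -⟩
    simp [RAMTest.Holds, h7, hF.natReg 0, hσ.size]
  · rintro c τ hc ⟨hF, h7, h9, hM⟩
    obtain ⟨i, hi, hci⟩ : ∃ i < n, n - c = i + 1 := ⟨n - c - 1, by omega, by omega⟩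
    have hE := hσ.of_frame hF (by norm_num)
    have e6 := (hF.natReg 6 (by norm_num)).trans h6
    -- This entry is loaded for every `i`. If bit `i` is set, it has no meaning as a boundary value,
    -- but it is later multiplied by zero.
    have eT : τ.realArr 1 (i * 2 ^ n + P + 2 ^ i) = σ.tab n (P + 2 ^ i) i := by
      rw [hF.realArr 1 (by norm_num), RAMState.tab, add_assoc]
    refine Runs.le (.natSub (v := i + 1) (by rw [hE.size, h7, hci]) <|
      .natSub (v := i) (by simp [hE.one]) <|
      .natLoad (v := 2 ^ i) (by simp [hE.pow i hi]) <|
      .natLoad (v := i * 2 ^ n) (by simp [hE.offset i hi]) <|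
      .natAdd (v := i * 2 ^ n + P) (by simp [e6]) <|
      .natAdd (v := i * 2 ^ n + P + 2 ^ i) (by simp) <|
      .realLoad (k := i * 2 ^ n + P + 2 ^ i) (x := σ.tab n (P + 2 ^ i) i) (by simp)
        (by simpa using eT) <|
      Runs.seq (t := 9 * n + 14) (runs_splitBit (n := n) (P := P) (i := i)
        (by simp [h9, hci]) (by simp)) ?_) ?_
    · rintro ρ ⟨hF1, g9, g2, g3, g4, gM⟩
      have hF2 : τ.Frame 8 ρ := .trans (by
        repeat first
          | exact .refl _ _
          | refine .setNat ?_ (by norm_num)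
          | refine .setReal ?_) hF1 (by norm_num)
      have hE1 := hE.of_frame hF2 (by norm_num)
      have g8 : ρ.natReg 8 = i := (hF1.natReg 8 (by norm_num)).trans (by simp)
      refine Runs.le (.realConst rfl <| .realConst rfl <| Runs.seq (t := 10)
        (runs_fillRow (hE1.of_frame (.setReal (.setReal (.refl 8 _))) (by norm_num)) hi
          (by simpa using g8) rfl (by simp) (by simp)) ?_) ?_
      · rintro π ⟨hF3, p2, p4, p5, pM⟩
        simp only [RAMState.mat_setReal] at pM
        have hF4 : ρ.Frame 10 π := .trans (.setReal (.setReal (.refl 10 _))) hF3 le_rfl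
        have hE2 := hE1.of_frame hF4 (by norm_num)
        have f8 := (hF4.natReg 8 (by norm_num)).trans g8
        have f7 := (hF4.natReg 7 (by norm_num)).trans ((hF2.natReg 7 (by norm_num)).trans h7)
        have f9 := (hF4.natReg 9 (by norm_num)).trans g9
        have f2 : π.realReg 2 = σ.tab n (P + 2 ^ i) i := p2.trans (by simp [g2])
        have f4 : π.realReg 4 = if P.testBit i then 0 else 1 := p4.trans (by simp [g4])
        simp only [RAMState.setReal_realReg] at p5 pM
        rw [Function.update_of_ne (by norm_num), Function.update_of_ne (by norm_num), g3] at p5 pM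
        have m1 := hE2.mul i hi.le
        have m2 := hE2.mul n le_rfl
        refine .natLoad (v := i * n) (by simp [f8, m1]) <|
          .natAdd (v := i * n + i) (by simp [f8]) <|
          .realAdd (x := M i i) (by simp [p5, f4, hMdef, systemMatrix, hi.ne]) <|
          .realStore (k := i * n + i) (x := M i i) (by simp) (by simp) <|
          .natLoad (v := n * n) (by simp [hE2.size, m2]) <|
          .natAdd (v := n * n + i) (by simp [f8]) <|
          .realMul (x := (if P.testBit i then 0 else 1) * σ.tab n (P + 2 ^ i) i)
            (by simp [f2, f4]) <|
          .realAdd (x := M i n) (by simp [p5, hMdef, systemMatrix]) <|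
          .realStore (k := n * n + i) (x := M i n) (by simp) (by simp) <|
          .incr (v := c + 1) (by simp [f7, hE2.one]) ⟨?_, by simp, ?_, fun i' hi' hi'' l hl => ?_⟩
        · have hF5 := (hF.trans hF2 (by norm_num)).trans hF4 (by norm_num)
          repeat first
            | exact hF5
            | refine .setNat ?_ (by norm_num)
            | refine .setReal ?_
            | refine .setRealArr ?_
        · have : n - (c + 1) = i := by omega
          simpa [this] using f9
        · rw [RAMState.mat_setNat, RAMState.mat_setRealArr _ hi hi' _ _ rfl]
          simp only [RAMState.mat_setNat, RAMState.mat_setReal]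
          rw [RAMState.mat_setRealArr _ hi hi' _ _ rfl]
          simp only [RAMState.mat_setNat, RAMState.mat_setReal]
          rw [pM i' hi' l hl, gM]
          -- In row `i` the diagonal entry left by `fillRow` has been overwritten and column `n`
          -- filled in.
          by_cases h1 : i' = i
          · subst h1
            by_cases h2 : l = n
            · simp [h2]
            · by_cases h3 : l = i'
              · simp [h3, hi.ne]
              · simp [h2, h3, lt_of_le_of_ne hl h2, hMdef, systemMatrix]
          · simp only [h1, false_and, if_false, RAMState.mat_setNat, RAMState.mat_setReal]
            exact hM i' hi' (by omega) l hl
      · omega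
    · omega
  · rintro τ ⟨hF, -, -, hM⟩
    exact ⟨hF, fun i hi l hl => hM i hi (by omega) l hl⟩
  · exact le_of_eq (by ring)

end CoverProg

/-! ### Storing solutions, tables of addresses and the main loop -/

namespace CoverProg

open RAMProg RAMTest

/-- Store the quotients of the last column and the diagonal of the matrix in the table, at the set
whose binary number is in the register `6`. -/
def storeSolution : RAMProg :=
  .natConst 7 0 ⨟
  .while (.natLt 7 0) (
    .natLoad 10 2 7 ⨟ .natAdd 10 10 7 ⨟ .realLoad 2 2 10 ⨟
    .natLoad 10 2 0 ⨟ .natAdd 10 10 7 ⨟ .realLoad 3 2 10 ⨟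
    .realDiv 2 3 2 ⨟
    .natLoad 10 1 7 ⨟ .natAdd 10 10 6 ⨟ .realStore 1 10 2 ⨟
    .natAdd 7 7 2)

theorem runs_storeSolution {n P : ℕ} {W : ℕ → ℕ → ℝ} {σ : RAMState} (hσ : Env n W σ)
    (hP : P < 2 ^ n) (h6 : σ.natReg 6 = P) (hd : ∀ i < n, σ.mat n i i ≠ 0) :
    storeSolution.Runs σ (12 * n + 2) fun τ => (∀ r < 7, τ.natReg r = σ.natReg r) ∧
      Env n W τ ∧ ∀ P' < 2 ^ n, ∀ i < n,
        τ.tab n P' i = if P' = P then σ.mat n i n / σ.mat n i i else σ.tab n P' i := by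
  refine Runs.le (.natConst <| Runs.mono (Runs.loop (m := n) (t := 11) (fun c τ =>
    ((∀ r < 7, τ.natReg r = σ.natReg r) ∧ Env n W τ) ∧ τ.natReg 7 = c ∧ τ.mat n = σ.mat n ∧
      ∀ P' < 2 ^ n, ∀ i < n,
        τ.tab n P' i = if P' = P ∧ i < c then σ.mat n i n / σ.mat n i i else σ.tab n P' i)
    ?_ ?_ ?_) le_rfl ?_) ?_
  · refine ⟨⟨fun r hr => Function.update_of_ne hr.ne _ _, hσ.congr (fun r hr =>
      Function.update_of_ne (by omega) _ _) rfl rfl⟩, by simp, by simp, by simp [RAMState.tab]⟩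
  · rintro c τ hc ⟨⟨hF, -⟩, h7, -⟩
    simp [RAMTest.Holds, h7, hF 0, hσ.size]
  · rintro c τ hc ⟨⟨hF, hE⟩, h7, hM, hT⟩
    have m1 := hE.mul c hc.le
    have m2 := hE.mul n le_rfl
    have e6 := (hF 6 (by norm_num)).trans h6
    have d1 : τ.realArr 2 (c * n + c) = σ.mat n c c := congrFun (congrFun hM c) c
    have d2 : τ.realArr 2 (n * n + c) = σ.mat n c n := congrFun (congrFun hM c) n
    refine .natLoad (v := c * n) (by simp [h7, m1]) <|
      .natAdd (v := c * n + c) (by simp [h7]) <|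
      .realLoad (k := c * n + c) (x := σ.mat n c c) (by simp) (by simpa using d1) <|
      .natLoad (v := n * n) (by simp [hE.size, m2]) <|
      .natAdd (v := n * n + c) (by simp [h7]) <|
      .realLoad (k := n * n + c) (x := σ.mat n c n) (by simp) (by simpa using d2) <|
      .realDiv (x := σ.mat n c n / σ.mat n c c) (by simpa using hd c hc) (by simp) <|
      .natLoad (v := c * 2 ^ n) (by simp [h7, hE.offset c hc]) <|
      .natAdd (v := c * 2 ^ n + P) (by simp [e6]) <|
      .realStore (k := c * 2 ^ n + P) (x := σ.mat n c n / σ.mat n c c) (by simp) (by simp) <|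
      .incr (v := c + 1) (by simp [h7, hE.one]) ?_
    refine ⟨⟨fun r hr => ?_, ?_⟩, by simp, ?_, fun P' hP' i hi => ?_⟩
    · rw [← hF r hr]
      simp [show r ≠ 7 by omega, show r ≠ 10 by omega]
    · refine hE.congr (fun r hr => ?_) rfl ?_
      · simp [show r ≠ 7 by omega, show r ≠ 10 by omega]
      · simp
    · rw [← hM]
      funext i l
      simp [RAMState.mat]
    · have ht := hT P' hP' i hi
      simp only [RAMState.tab] at ht ⊢
      simp only [RAMState.setNat_realArr, RAMState.setReal_realArr, RAMState.setRealArr_realArr,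
        Function.update_self, Function.update_apply, RAMState.address_inj hP hP', ht]
      grind
  · rintro τ ⟨⟨hF, hE⟩, -, -, hT⟩
    refine ⟨hF, hE, fun P' hP' i hi => ?_⟩
    rw [hT P' hP' i hi]
    simp [hi]
  · omega

/-- Tabulate the multiples of the register `d` in the natural array `m`, up to the bound in the
register `b`. -/
def fillMultiples (m b d : ℕ) : RAMProg :=
  .natConst 5 0 ⨟ .natConst 6 0 ⨟
  .while (.natLt 5 b) (.natStore m 5 6 ⨟ .natAdd 6 6 d ⨟ .natAdd 5 5 2)

theorem runs_fillMultiples {m b d B : ℕ} {σ : RAMState} (hb : b < 5) (hd : d < 5)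
    (h2 : σ.natReg 2 = 1) (hB : σ.natReg b = B) :
    (fillMultiples m b d).Runs σ (4 * B + 3) fun τ => (∀ r < 5, τ.natReg r = σ.natReg r) ∧
      τ.realArr = σ.realArr ∧ (∀ m', m' ≠ m → τ.natArr m' = σ.natArr m') ∧
      ∀ l < B, τ.natArr m l = l * σ.natReg d := by
  refine Runs.le (.natConst <| .natConst <| Runs.mono (Runs.loop (m := B) (t := 3) (fun c τ =>
    ((∀ r < 5, τ.natReg r = σ.natReg r) ∧
      τ.realArr = σ.realArr ∧ (∀ m', m' ≠ m → τ.natArr m' = σ.natArr m') ∧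
      ∀ l < c, τ.natArr m l = l * σ.natReg d) ∧ τ.natReg 5 = c ∧ τ.natReg 6 = c * σ.natReg d)
    ?_ ?_ ?_) le_rfl fun τ h => h.1) ?_
  · refine ⟨⟨fun r hr => ?_, rfl, fun _ _ => rfl, by simp⟩, by simp, by simp⟩
    simp [show r ≠ 5 by omega, show r ≠ 6 by omega]
  · rintro c τ hc ⟨⟨hF, -⟩, h5, -⟩
    simp [RAMTest.Holds, h5, hF b hb, hB]
  · rintro c τ hc ⟨⟨hF, hA, hN, hT⟩, h5, h6⟩
    refine .natStore (k := c) (v := c * σ.natReg d) h5 h6 <|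
      .natAdd (v := (c + 1) * σ.natReg d) (by simp [h6, hF d hd, add_mul]) <|
      .incr (v := c + 1) (by simp [h5, hF 2, h2])
        ⟨⟨fun r hr => ?_, hA, fun m' hm' => ?_, fun l hl => ?_⟩, by simp, by simp⟩
    · rw [← hF r hr]
      simp [show r ≠ 5 by omega, show r ≠ 6 by omega]
    · simp [hm', hN m' hm']
    · by_cases h : l = c
      · simp [h]
      · simp [h, hT l (by omega)]
  · omega

/-- Compute the constants and the tables of natural numbers. -/
def initialization : RAMProg :=
  .natConst 2 1 ⨟ .natAdd 4 0 2 ⨟ .natConst 3 1 ⨟ .natConst 5 0 ⨟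
  .while (.natLt 5 0) (.natStore 0 5 3 ⨟ .natAdd 3 3 3 ⨟ .natAdd 5 5 2) ⨟
  fillMultiples 1 0 3 ⨟ fillMultiples 2 4 0

/-- The machine cannot multiply natural numbers: powers of two arise by doubling and multiples by
repeated addition, so that later addresses need only table lookups and sums. -/
theorem runs_initialization {n : ℕ} {W : ℕ → ℕ → ℝ} {σ : RAMState} (h0 : σ.natReg 0 = n)
    (hW : ∀ i < n, ∀ l < n, σ.realArr 0 (l * n + i) = W i l) :
    initialization.Runs σ (12 * n + 15) fun τ =>
      Env n W τ ∧ τ.natReg 1 = σ.natReg 1 ∧ τ.realArr = σ.realArr := by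
  refine Runs.le (.natConst <| .natAdd (v := n + 1) (by simp [h0]) <| .natConst <| .natConst <|
    Runs.seq (t := (4 * n + 3) + (4 * (n + 1) + 3)) (Runs.loop (m := n) (t := 3) (fun c τ =>
      τ.natReg 0 = n ∧ τ.natReg 1 = σ.natReg 1 ∧ τ.natReg 2 = 1 ∧ τ.natReg 3 = 2 ^ c ∧
      τ.natReg 4 = n + 1 ∧ τ.natReg 5 = c ∧ τ.realArr = σ.realArr ∧
      ∀ j < c, τ.natArr 0 j = 2 ^ j) ?_ ?_ ?_) ?_) ?_
  · simp [h0]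
  · rintro c τ hc ⟨h0, -, -, -, -, h5, -⟩
    simp [RAMTest.Holds, h0, h5]
  · rintro c τ hc ⟨h0, h1, h2, h3, h4, h5, hA, hT⟩
    refine .natStore (k := c) (v := 2 ^ c) h5 h3 <|
      .natAdd (v := 2 ^ (c + 1)) (by simp [h3, pow_succ, mul_two]) <|
      .incr (v := c + 1) (by simp [h5, h2])
        ⟨by simp [h0], by simp [h1], by simp [h2], by simp, by simp [h4], by simp, hA,
          fun j hj => ?_⟩
    by_cases h : j = c
    · simp [h]
    · simp [h, hT j (by omega)]
  · rintro τ ⟨h0, h1, h2, h3, h4, -, hA, hT⟩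
    refine Runs.seq (runs_fillMultiples (by norm_num) (by norm_num) h2 h0) ?_
    rintro ρ ⟨hF, hA1, hN1, hT1⟩
    refine Runs.mono (runs_fillMultiples (B := n + 1) (by norm_num) (by norm_num)
      ((hF 2 (by norm_num)).trans h2) ((hF 4 (by norm_num)).trans h4)) le_rfl ?_
    rintro π ⟨hF2, hA2, hN2, hT2⟩
    have hF' : ∀ r < 5, π.natReg r = τ.natReg r := fun r hr => (hF2 r hr).trans (hF r hr)
    have hA' : π.realArr = σ.realArr := hA2.trans (hA1.trans hA)
    refine ⟨⟨⟨(hF' 0 (by norm_num)).trans h0, (hF' 2 (by norm_num)).trans h2,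
      (hF' 4 (by norm_num)).trans h4, fun l hl => ?_⟩, (hF' 3 (by norm_num)).trans h3,
      fun j hj => ?_, fun j hj => ?_, fun i hi l hl => ?_⟩, (hF' 1 (by norm_num)).trans h1, hA'⟩
    · rw [hT2 l (by omega), hF 0 (by norm_num), h0]
    · rw [hN2 0 (by norm_num), hN1 0 (by norm_num), hT j hj]
    · rw [hN2 1 (by norm_num), hT1 j hj, h3]
    · rw [hA', hW i hi l hl]
  · omega

/-- Treat all sets of vertices, in decreasing order of their binary numbers. -/
def mainLoop : RAMProg :=
  .natConst 5 1 ⨟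
  .while (.natLt 5 3) (
    .natSub 6 3 5 ⨟ .natSub 6 6 2 ⨟ assemble ⨟ elimination ⨟ storeSolution ⨟ .natAdd 5 5 2)

/-- The values `H P i` solve the linear systems of the algorithm. -/
structure Solves (n : ℕ) (W : ℕ → ℕ → ℝ) (H : ℕ → ℕ → ℝ) : Prop where
  full : ∀ i < n, H (2 ^ n - 1) i = 0
  regular : ∀ P < 2 ^ n - 1, ∀ T, LeadingRegular n (systemMatrix n W P T)
  solution : ∀ P < 2 ^ n - 1, ∀ T : ℕ → ℝ,
    (∀ i < n, P.testBit i = false → T i = H (P + 2 ^ i) i) → ∀ i < n,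
    elim (systemMatrix n W P T) n i n / elim (systemMatrix n W P T) n i i = H P i

theorem add_two_pow_lt {n P i : ℕ} (hP : P < 2 ^ n) (hi : i < n) (h : P.testBit i = false) :
    P + 2 ^ i < 2 ^ n := by
  refine Nat.lt_pow_two_of_testBit _ fun j hj => ?_
  rw [Nat.testBit_add_two_pow h, Nat.testBit_lt_two_pow
    (hP.trans_le (Nat.pow_le_pow_right (by norm_num) hj))]
  simp; omega

theorem runs_mainLoop {n : ℕ} {W H : ℕ → ℕ → ℝ} (hH : Solves n W H) {σ : RAMState}
    (hσ : Env n W σ) (hT : ∀ a, σ.realArr 1 a = 0) :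
    mainLoop.Runs σ (2 ^ n * (101 * (n + 1) ^ 3 + 1) + 2) fun τ =>
      Env n W τ ∧ τ.natReg 1 = σ.natReg 1 ∧ ∀ i < n, τ.realArr 1 (i * 2 ^ n) = H 0 i := by
  have hN : 1 ≤ 2 ^ n := Nat.one_le_two_pow
  -- Pass `j` has `j + 1` in register `5` and treats `P = 2 ^ n - 2 - j`, so the full set is skipped
  -- and the last pass treats the empty set.
  refine Runs.le (.natConst <| Runs.mono (Runs.loop (m := 2 ^ n - 1) (t := 101 * (n + 1) ^ 3)
    (fun j τ => Env n W τ ∧ τ.natReg 1 = σ.natReg 1 ∧ τ.natReg 5 = j + 1 ∧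
      ∀ P < 2 ^ n, 2 ^ n - 1 - j ≤ P → ∀ i < n, τ.tab n P i = H P i) ?_ ?_ ?_) le_rfl ?_) ?_
  · refine ⟨hσ.congr (fun r hr => Function.update_of_ne (by omega) _ _) rfl rfl, by simp, by simp,
      fun P hP hP' i hi => ?_⟩
    -- The full set needs no computation: its values are the zeros initially in memory.
    obtain rfl : P = 2 ^ n - 1 := by omega
    rw [hH.full i hi]
    exact hT _
  · rintro j τ hj ⟨hE, -, h5, -⟩
    simp only [RAMTest.Holds, h5, hE.card]
    omega
  · rintro j τ hj ⟨hE, h1, h5, hT⟩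
    obtain ⟨P, hP, hjP⟩ : ∃ P < 2 ^ n - 1, 2 ^ n - 1 - j = P + 1 :=
      ⟨2 ^ n - 1 - j - 1, by omega, by omega⟩
    set T : ℕ → ℝ := fun i => τ.tab n (P + 2 ^ i) i with hTdef
    -- The boundary values are in the table already, because `P + 2 ^ i` exceeds `P`, and without a
    -- carry out of the last `n` bits it stays below `2 ^ n`.
    have hsol := hH.solution P hP T fun i hi hb =>
      hT _ (add_two_pow_lt (by omega) hi hb) (by have := Nat.one_le_two_pow (n := i); omega) i hi
    have hreg := hH.regular P hP T
    refine Runs.le (.natSub (v := P + 1) (by rw [hE.card, h5]; omega) <|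
      .natSub (v := P) (by simp [hE.one]) <|
      Runs.seq (t := 50 * (n + 1) ^ 3 + ((12 * n + 2) + 1)) (runs_assemble (P := P) (hE.of_frame
        (.setNat (.setNat (.refl 6 _) le_rfl) le_rfl) (by norm_num)) (by omega) (by simp)) ?_) ?_
    · rintro ρ ⟨hF1, hM1⟩
      replace hM1 : ∀ i < n, ∀ l ≤ n, ρ.mat n i l = systemMatrix n W P T i l := hM1
      have hF2 : τ.Frame 6 ρ := .trans (.setNat (.setNat (.refl 6 _) le_rfl) le_rfl) hF1
        (by norm_num)
      have hE1 := hE.of_frame hF2 (by norm_num)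
      refine Runs.seq (runs_elimination hE1.toConsts fun k hk => ?_) ?_
      · rw [elim_congr hM1 hk.le k hk k hk.le]
        exact hreg.pivot_ne_zero hk
      · rintro π ⟨hF3, hM3⟩
        have hM4 : ∀ i < n, ∀ l ≤ n, π.mat n i l = elim (systemMatrix n W P T) n i l :=
          fun i hi l hl => (hM3 i hi l hl).trans (elim_congr hM1 le_rfl i hi l hl)
        have hF4 := hF2.trans hF3 (by norm_num)
        refine Runs.seq (runs_storeSolution (P := P) (hE1.of_frame hF3 (by norm_num)) (by omega)
          ?_ fun i hi => ?_) ?_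
        · rw [hF3.natReg 6 (by norm_num), hF1.natReg 6 (by norm_num)]
          simp
        · rw [hM4 i hi i hi.le]
          exact hreg.diag_ne_zero hi
        · rintro θ ⟨hF5, hE5, hT5⟩
          refine .incr (v := j + 1 + 1) ?_ ⟨hE5.congr (fun r hr =>
            Function.update_of_ne (by omega) _ _) rfl rfl, ?_, by simp, fun P' hP1 hP2 i hi => ?_⟩
          · rw [hF5 5 (by norm_num), hF4.natReg 5 (by norm_num), h5, hE5.one]
          · rw [← h1, ← hF4.natReg 1 (by norm_num), ← hF5 1 (by norm_num)]
            simp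
          · refine Eq.trans (hT5 P' hP1 i hi) ?_
            split_ifs with h
            · rw [hM4 i hi n le_rfl, hM4 i hi i hi.le, h]
              exact hsol i hi
            · rw [RAMState.tab, hF4.realArr 1 (by norm_num)]
              exact hT P' hP1 (by omega) i hi
    · nlinarith [Nat.zero_le (n ^ 2), Nat.zero_le (n ^ 3)]
  · rintro τ ⟨hE, h1, -, hT⟩
    exact ⟨hE, h1, fun i hi => hT 0 (by omega) (by omega) i hi⟩
  · have := Nat.mul_le_mul_right (101 * (n + 1) ^ 3 + 1) (Nat.sub_le (2 ^ n) 1)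
    omega

/-- The program which computes cover times. -/
def coverProg : RAMProg :=
  initialization ⨟ mainLoop ⨟ .natLoad 10 1 1 ⨟ .realLoad 0 1 10

theorem runs_coverProg {n i : ℕ} {W H : ℕ → ℕ → ℝ} (hH : Solves n W H) {σ : RAMState}
    (hi : i < n) (h0 : σ.natReg 0 = n) (h1 : σ.natReg 1 = i)
    (hW : ∀ i < n, ∀ l < n, σ.realArr 0 (l * n + i) = W i l) (hT : ∀ a, σ.realArr 1 a = 0) :
    coverProg.Runs σ (1000 * n ^ 3 * 2 ^ n) fun τ => τ.realReg 0 = H 0 i := by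
  refine Runs.le (Runs.seq (t := 2 ^ n * (101 * (n + 1) ^ 3 + 1) + 2 + 2)
    (runs_initialization h0 hW) ?_) ?_
  · rintro τ ⟨hE, h1', hA⟩
    refine Runs.seq (runs_mainLoop hH hE fun a => by rw [hA]; exact hT a) ?_
    rintro ρ ⟨hE', h1'', hT'⟩
    have e1 : ρ.natReg 1 = i := h1''.trans (h1'.trans h1)
    refine .natLoad (v := i * 2 ^ n) (by rw [e1, hE'.offset i hi]) <| .last (.realLoad ..) ?_
    simp [hT' i hi]
  · have hN : 1 ≤ 2 ^ n := Nat.one_le_two_pow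
    have hn : 1 ≤ n := by omega
    have h3 : n ≤ n ^ 3 := Nat.le_self_pow (by norm_num) n
    have h8 : (n + 1) ^ 3 ≤ 8 * n ^ 3 := by
      calc (n + 1) ^ 3 ≤ (2 * n) ^ 3 := Nat.pow_le_pow_left (by omega) 3
        _ = 8 * n ^ 3 := by ring
    -- Since a starting vertex exists, `1 ≤ n ^ 3`, and `101 * 8 + 1 = 809`.
    have h4 : 2 ^ n * (101 * (n + 1) ^ 3 + 1) ≤ 2 ^ n * (809 * n ^ 3) :=
      Nat.mul_le_mul_left _ (by omega)
    have h5 : n ^ 3 ≤ n ^ 3 * 2 ^ n := Nat.le_mul_of_pos_right _ (by omega)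
    have h6 : 2 ^ n * (809 * n ^ 3) = 809 * (n ^ 3 * 2 ^ n) := by ring
    have h7 : 1000 * n ^ 3 * 2 ^ n = 1000 * (n ^ 3 * 2 ^ n) := by ring
    omega

theorem coverInput_weight {n : ℕ} (G : WeightedGraph (Fin n)) (s : Fin n) {i l : ℕ} (hi : i < n)
    (hl : l < n) : (coverInput G s).realArr 0 (l * n + i) = natWeight G i l := by
  have h : ∀ k m : Fin n, (l * n + i = (k : ℕ) * n + m) ↔ k = ⟨l, hl⟩ ∧ m = ⟨i, hi⟩ := by
    intro k m
    rw [eq_comm, RAMState.address_inj hi m.2]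
    simp only [Fin.ext_iff, and_comm]
  simp only [coverInput, if_true, h, ite_and, natWeight, hi, hl, and_self, dif_pos]
  -- The input is stored by rows but read by columns; symmetry of the weights reconciles the two.
  simp [G.weight_symm ⟨i, hi⟩]

theorem solves_coverValue {n : ℕ} {G : WeightedGraph (Fin n)} (hG : G.graph.Connected) :
    Solves n (natWeight G) (coverValue G) :=
  ⟨fun i _ => coverValue_full i, fun _ hP => leadingRegular_systemMatrix hG hP,
    fun _ hP _ hT _ hi => coverValue_solution hG hP hT hi⟩

end CoverProg

end

theorem mainTheorem5 :
    (∀ (V : Type*) [Fintype V] [DecidableEq V] [MeasurableSpace V] [MeasurableSingletonClass V]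
      (G : WeightedGraph V), G.graph.Connected →
      -- the cover time as a hitting time in the associated graph
      (∀ i, G.coverTime i = G.hitCovered {i} i) ∧
      (∀ i, G.hitCovered Finset.univ i = 0) ∧
      -- the recursion, with finite hitting times
      (∀ (P : Finset V) (i : V), i ∈ P → P ≠ Finset.univ →
        G.hitCovered P i ≠ ∞ ∧
        G.hitCovered P i =
          1 + G.stayTime P i + ∑ j ∈ Pᶜ, G.exitProb P i j * G.hitCovered (insert j P) j) ∧
      -- `1 + s(P,i)` is the hitting time to the complement of `P`
      (∀ (P : Finset V) (i : V), i ∈ P → P ≠ Finset.univ →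
        hittingTime G.step i {v | v ∉ P} = 1 + G.stayTime P i) ∧
      -- `p(P,·,j)` is the harmonic potential
      (∀ (P : Finset V) (j : V), j ∉ P → ∀ φ : V → ℝ,
        G.IsPotential P j φ ↔ φ = fun i => (G.exitProb P i j).toReal)) ∧
    -- the algorithm
    (∃ (prog : RAMProg) (C : ℕ), ∀ (n : ℕ) (G : WeightedGraph (Fin n)), G.graph.Connected →
      ∀ i : Fin n, ∃ (t : ℕ) (σ : RAMState),
        RAMProg.Exec prog (coverInput G i) t σ ∧
        t ≤ C * n ^ 3 * 2 ^ n ∧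
        σ.realReg 0 = (G.coverTime i).toReal) := by
  refine ⟨fun V _ _ _ _ G hG => ⟨G.coverTime_eq_hitCovered, G.hitCovered_univ,
    fun P i hi hP => ⟨WeightedGraph.hitCovered_ne_top hG hi,
      WeightedGraph.hitCovered_recursion hG hP hi⟩,
    fun P i hi _ => WeightedGraph.hittingTime_compl_eq hi,
    fun P j hj φ => WeightedGraph.isPotential_iff hG hj φ⟩,
    CoverProg.coverProg, 1000, fun n G hG i => ?_⟩
  obtain ⟨t, σ, h1, h2, h3⟩ := CoverProg.runs_coverProg (CoverProg.solves_coverValue hG)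
    (σ := coverInput G i) i.2 rfl rfl (fun k hk l hl => CoverProg.coverInput_weight G i hk hl)
    fun a => rfl
  exact ⟨t, σ, h1, h2, h3.trans (coverValue_zero i)⟩
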